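/- Let $D\ge 2$ and let $\Omega\subset\mathbb R^D$ be a bounded domain (open and connected) with $C^2$ boundary, outward unit normal $\mathrm n$ and surface measure $d\sigma$. Let $\mathbb H=L^2(\Omega;\mathbb C\times\mathbb C^D\times\mathbb C)$ with inner product $$\langle U_1|U_2\rangle=\int_\Omega\Big(\rho_1\overline{\rho_2}+\mathrm u_1\cdot\overline{\mathrm u_2}+\tfrac D2\theta_1\overline{\theta_2}\Big)dx,\qquad U_j=(\rho_j,\mathrm u_j,\theta_j),$$ and let $\mathcal A(\rho,\mathrm u,\theta)=\big(\nabla\cdot\mathrm u,\ \nabla(\rho+\theta),\ \tfrac2D\nabla\cdot\mathrm u\big)$, where the derivatives are weak derivatives in $L^2(\Omega)$. Let $0<\lambda^1\le\lambda^2\le\cdots\to\infty$ and let $\Psi^1,\Psi^2,\dots\in H^1(\Omega)$ be real-valued with $-\Delta\Psi^k=\tfrac{D}{D+2}(\lambda^k)^2\Psi^k$ in $\Omega$, $\nabla\Psi^k\cdot\mathrm n=0$ on $\partial\Omega$ (in the variational sense), such that the $\Psi^k$ together with the normalized constant function form an orthonormal basis of $L^2(\Omega)$. For $\tau\in\{+,-\}$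 put $\lambda^{\tau,k}=\tau\lambda^k$ and $$U^{\tau,k}=c_D\Big(\tfrac{D}{D+2}\Psi^k,\ \tfrac{\nabla\Psi^k}{i\lambda^{\tau,k}},\ \tfrac{2}{D+2}\Psi^k\Big),\qquad c_D=\sqrt{\tfrac{D+2}{2D}}.$$ $\mathrm{Ker}(\mathcal A-i\lambda^{\tau,k})$ denotes the set of $V=(\rho,\mathrm v,\theta)\in\mathbb H$ with $\mathcal AV=i\lambda^{\tau,k}V$ in $\Omega$ and $\mathrm v\cdot\mathrm n=0$ on $\partial\Omega$; normal traces are understood in the weak sense (Green's formula). Fix $k\ge1$, $\tau\in\{+,-\}$, $\mu\in\mathbb C$, $F\in\mathbb H$ and $g\in L^2(\partial\Omega;\mathbb C)$ (in particular, any $g\in H^{1/2}(\partial\Omega)$), and consider the problem for $V=(\rho,\mathrm v,\theta)\in\mathbb H$ $$(\mathcal A-i\lambda^{\tau,k})V=i\mu\,U^{\tau,k}+F\ \text{ in }\Omega,\qquad \mathrm v\cdot\mathrm n=g\ \text{ on }\partial\Omega,\tag{P}$$ together with the conditions $$i\mu=c_D\int_{\partial\Omega}g\,\Psi^k\,d\sigma-\langle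 F|U^{\tau,k}\rangle,\tag{1}$$ $$c_D\int_{\partial\Omega}g\,\Psi^l\,d\sigma=\langle F|U^{\tau,l}\rangle\quad\text{for all } l\ne k \text{ with }\lambda^l=\lambda^k.\tag{2}$$ (i) If the eigenvalue is simple ($\lambda^l=\lambda^k$ only for $l=k$), then (P) has a solution if and only if (1) holds. (ii) In general, in particular when the eigenvalue is multiple, (P) has a solution if and only if both (1) and (2) hold. When these conditions hold, (P) has exactly one solution $V_1\in\mathrm{Ker}(\mathcal A-i\lambda^{\tau,k})^\perp$; the set of all solutions is $V_1+\mathrm{Ker}(\mathcal A-i\lambda^{\tau,k})$; and every solution $V$ satisfies $$V=\sum_{l:\,\lambda^l=\lambda^k}\langle V|U^{\tau,l}\rangle\,U^{\tau,l}+V_1 .$$ -/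

import Mathlib

open MeasureTheory Filter Topology
open scoped ContDiff ENNReal ComplexConjugate

noncomputable section

/-- Euclidean space `ℝ^D`. -/
abbrev Pt (D : ℕ) := EuclideanSpace ℝ (Fin D)

/-- `L²(Ω; ℂ)`. -/
abbrev L2S {D : ℕ} (Ω : Set (Pt D)) := Lp ℂ 2 ((volume : Measure (Pt D)).restrict Ω)

/-- `L²(Ω; ℂ^D)`. -/
abbrev L2V {D : ℕ} (Ω : Set (Pt D)) :=
  Lp (EuclideanSpace ℂ (Fin D)) 2 ((volume : Measure (Pt D)).restrict Ω)

/-- The space of states `U = (ρ, u, θ)` in `L²(Ω; ℂ × ℂ^D × ℂ)`. Its inner product is `hInner`;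
the norm that Lean puts on a product is never used. -/
abbrev StateSpace {D : ℕ} (Ω : Set (Pt D)) := L2S Ω × L2V Ω × L2S Ω

/-- `⟨U, V⟩ = ∫_Ω (ρ_U conj ρ_V + u_U · conj u_V + (D/2) θ_U conj θ_V) dx`. -/
def hInner {D : ℕ} {Ω : Set (Pt D)} (U V : StateSpace Ω) : ℂ :=
  ∫ x in Ω, (U.1 x * conj (V.1 x) + ∑ i, U.2.1 x i * conj (V.2.1 x i)
    + ((D : ℂ) / 2) * (U.2.2 x * conj (V.2.2 x)))

/-- `Ω` has a `C²` boundary: near each boundary point, in suitable orthonormal coordinates with last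
axis `ν`, the set `Ω` is the region strictly below the graph of a `C²` function `γ` of the
component of the point orthogonal to `ν`. -/
def HasC2Boundary {D : ℕ} (Ω : Set (Pt D)) : Prop :=
  ∀ x ∈ frontier Ω, ∃ (ν : Pt D) (γ : Pt D → ℝ) (r : ℝ), ‖ν‖ = 1 ∧ ContDiff ℝ 2 γ ∧ 0 < r ∧
    ∀ y ∈ Metric.ball x r, y ∈ Ω ↔ inner ℝ ν y < γ (y - (inner ℝ ν y : ℝ) • ν)

/-- Surface measure on `∂Ω`: the `(D-1)`-dimensional Hausdorff measure, normalized so that it agrees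
with Lebesgue measure on `ℝ^(D-1)`, restricted to `∂Ω`. -/
def surfaceMeasure {D : ℕ} (Ω : Set (Pt D)) : Measure (Pt D) :=
  (Measure.euclideanHausdorffMeasure (D - 1) : Measure (Pt D)).restrict (frontier Ω)

/-- Complex test functions in `C_c^∞(ℝ^D)`. -/
def IsTest {D : ℕ} (φ : Pt D → ℂ) : Prop := ContDiff ℝ ∞ φ ∧ HasCompactSupport φ

/-- The gradient of `φ` at `x`, as the vector of its partial derivatives. -/
def gradC {D : ℕ} (φ : Pt D → ℂ) (x : Pt D) : EuclideanSpace ℂ (Fin D) :=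
  WithLp.toLp 2 fun i => fderiv ℝ φ x (EuclideanSpace.single i 1)

/-- `G = ∇f` in the sense of weak derivatives on `Ω`; thus `HasWeakGrad Ω f G` for some `G` says
`f ∈ H¹(Ω)`. -/
def HasWeakGrad {D : ℕ} (Ω : Set (Pt D)) (f : L2S Ω) (G : L2V Ω) : Prop :=
  ∀ φ : Pt D → ℂ, IsTest φ → tsupport φ ⊆ Ω → ∀ i,
    (∫ x in Ω, f x * gradC φ x i) = -(∫ x in Ω, G x i * φ x)

/-- `d = ∇ · v` in the sense of weak derivatives on `Ω`. -/
def HasWeakDiv {D : ℕ} (Ω : Set (Pt D)) (v : L2V Ω) (d : L2S Ω) : Prop :=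
  ∀ φ : Pt D → ℂ, IsTest φ → tsupport φ ⊆ Ω →
    (∫ x in Ω, ∑ i, v x i * gradC φ x i) = -(∫ x in Ω, d x * φ x)

/-- `v · n = g` on `∂Ω` (with `n` the outward unit normal) for a field `v ∈ L²` whose weak divergence
is `d ∈ L²`, in the usual sense of Green's formula. -/
def HasNormalTrace {D : ℕ} (Ω : Set (Pt D)) (v : L2V Ω) (d : L2S Ω) (g : Pt D → ℂ) : Prop :=
  ∀ φ : Pt D → ℂ, IsTest φ →
    (∫ x in Ω, ((∑ i, v x i * gradC φ x i) + d x * φ x)) = ∫ x, g x * φ x ∂(surfaceMeasure Ω)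

/-- `t ∈ L²(∂Ω)` is the trace on `∂Ω` of the function `f ∈ H¹(Ω)` with weak gradient `G`: the pair is
a limit, in `H¹(Ω)` and in `L²(∂Ω)`, of functions smooth up to the boundary and their boundary
values. -/
def IsTrace {D : ℕ} (Ω : Set (Pt D)) (f : L2S Ω) (G : L2V Ω) (t : Pt D → ℂ) : Prop :=
  MemLp t 2 (surfaceMeasure Ω) ∧ ∃ φ : ℕ → Pt D → ℂ, (∀ j, IsTest (φ j)) ∧
    Tendsto (fun j => eLpNorm (fun x => f x - φ j x) 2 (volume.restrict Ω)) atTop (𝓝 0) ∧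
    Tendsto (fun j => eLpNorm (fun x => G x - gradC (φ j) x) 2 (volume.restrict Ω)) atTop (𝓝 0) ∧
    Tendsto (fun j => eLpNorm (fun x => t x - φ j x) 2 (surfaceMeasure Ω)) atTop (𝓝 0)

/-- `W` is the value at `U = (ρ, u, θ)` of the acoustic expression
`(∇ · u, ∇(ρ + θ), (2/D) ∇ · u)`, with no boundary condition on `u`. -/
def HasAcoustic {D : ℕ} (Ω : Set (Pt D)) (U W : StateSpace Ω) : Prop :=
  HasWeakDiv Ω U.2.1 W.1 ∧ HasWeakGrad Ω (U.1 + U.2.2) W.2.1 ∧ W.2.2 = (2 / (D : ℂ)) • W.1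

/-- `V = (ρ, v, θ)` solves `(𝒜 - i s) V = R` in `Ω`, `v · n = g` on `∂Ω`. -/
def SolvesAcoustic {D : ℕ} (Ω : Set (Pt D)) (s : ℝ) (R : StateSpace Ω) (g : Pt D → ℂ)
    (V : StateSpace Ω) : Prop :=
  ∃ W : StateSpace Ω, HasAcoustic Ω V W ∧ W - (Complex.I * (s : ℂ)) • V = R ∧
    HasNormalTrace Ω V.2.1 W.1 g

/-- `Ker(𝒜 - i s)`, where the domain of `𝒜` carries the boundary condition `v · n = 0`. -/
def acousticKer {D : ℕ} (Ω : Set (Pt D)) (s : ℝ) : Set (StateSpace Ω) :=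
  {V | SolvesAcoustic Ω s 0 0 V}

/-- The orthogonal complement of `Ker(𝒜 - i s)` for the inner product `hInner`. -/
def acousticKerPerp {D : ℕ} (Ω : Set (Pt D)) (s : ℝ) : Set (StateSpace Ω) :=
  {V | ∀ K ∈ acousticKer Ω s, hInner V K = 0}

/-- The nonzero Neumann spectrum of `-Δ` on a connected bounded `Ω`, with multiplicity: `Ψ k` are real
eigenfunctions with weak gradients `dΨ k` and eigenvalues `D/(D+2) (lam k)²` (the Neumann problem is
taken in its usual variational form), orthonormal in `L²(Ω)`, and complete among the functions of mean
zero, that is, an orthonormal basis of `L²(Ω)` together with the constant mode. -/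
structure IsNeumannBasis {D : ℕ} (Ω : Set (Pt D)) (lam : ℕ → ℝ) (Ψ : ℕ → L2S Ω)
    (dΨ : ℕ → L2V Ω) : Prop where
  pos : ∀ k, 0 < lam k
  mono : Monotone lam
  tendsto : Tendsto lam atTop atTop
  real : ∀ k, ∀ᵐ x ∂((volume : Measure (Pt D)).restrict Ω), (Ψ k x).im = 0
  weakGrad : ∀ k, HasWeakGrad Ω (Ψ k) (dΨ k)
  eigen : ∀ k (q : L2S Ω) (dq : L2V Ω), HasWeakGrad Ω q dq →
    inner ℂ dq (dΨ k) = ((D : ℂ) / (D + 2) * (lam k : ℂ) ^ 2) * inner ℂ q (Ψ k)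
  orthonormal : Orthonormal ℂ Ψ
  complete : ∀ f : L2S Ω, (∫ x in Ω, f x) = 0 → (∀ k, inner ℂ (Ψ k) f = 0) → f = 0

/-- The constant `√((D+2)/(2D))` that normalizes the acoustic modes. -/
def modeConst (D : ℕ) : ℂ := ((Real.sqrt (((D : ℝ) + 2) / (2 * D)) : ℝ) : ℂ)

/-- The acoustic mode
`√((D+2)/(2D)) (D/(D+2) Ψ, ∇Ψ/(i s), 2/(D+2) Ψ)`. -/
def acousticMode {D : ℕ} {Ω : Set (Pt D)} (s : ℝ) (Ψ : L2S Ω) (dΨ : L2V Ω) : StateSpace Ω :=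
  modeConst D • (((D : ℂ) / (D + 2)) • Ψ, (1 / (Complex.I * (s : ℂ))) • dΨ,
    (2 / ((D : ℂ) + 2)) • Ψ)

end

/-!
Put `q = ρ + θ`. The first and third components of `(𝒜 - i s) V = R` give
`∇ · v = D/(D+2) (i s q + R₁ + R₃)`, the second gives `i s v = ∇q - R₂`, and Green's formula then
says that `q ∈ H¹(Ω)` solves a Neumann problem for the Helmholtz equation in variational form,
`⟨p, ∇q⟩ - z ⟨p, q⟩ = ⟨p, load⟩` with `z = D/(D+2) s²` (`IsWeakAcousticSol.helmholtz`,
`exists_isWeakAcousticSol_of_helmholtz`). Since the Neumann eigenfunctions diagonalize this problem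
and their eigenvalues do not accumulate at `z`, the Fredholm alternative holds: the problem is
solvable exactly if the load is orthogonal to the resonant pairs `(Ψ^l, ∇Ψ^l)`, and these span the
solutions of the homogeneous problem (`IsEigenfamily.exists_solution`,
`IsEigenfamily.inner_load_eq_zero`, `IsEigenfamily.eq_sum_of_homogeneous`). Up to a nonzero factor,
the pairing of the load with `(Ψ^l, ∇Ψ^l)` is `c_D ∫_{∂Ω} g Ψ^l dσ - ⟨R | U^l⟩`
(`inner_helmholtzLoad_eq_zero_iff`). As the resonant modes `U^l` are orthonormal, its vanishing for
`R = i μ U^k + F` is the condition on `μ` when `l = k`, and the compatibility condition otherwise.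

The analytic input is that `φ ↦ ∫_{∂Ω} g φ dσ` is bounded in the norm of `H¹(Ω)`
(`exists_representsBoundary`), which follows from the trace inequality `exists_trace_le`. That
inequality is proved in local graph coordinates: the Hausdorff measure of the graph is controlled by
Lebesgue measure on the hyperplane `ν^⊥` because the graph map is Lipschitz, and the boundary values
of `φ` are controlled by the fundamental theorem of calculus along the segments that enter `Ω` in
the direction `-ν`. Green's formula is given for test functions on the whole space only, but the
eigenpairs are limits of such functions, and they span a dense subspace of `H¹(Ω)`, so the formula
extends to all of `H¹(Ω)` (`hasNormalTrace_iff`).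
-/

/-! ### Integration over a layer below a graph -/

theorem fderiv_apply_eq_sum_gradC {D : ℕ} (φ : Pt D → ℂ) (x v : Pt D) :
    fderiv ℝ φ x v = ∑ i, (v i : ℂ) * gradC φ x i := by
  conv_lhs => rw [← (EuclideanSpace.basisFun (Fin D) ℝ).sum_repr v]
  simp [gradC, map_sum]

theorem norm_fderiv_apply_le_norm_gradC {D : ℕ} (φ : Pt D → ℂ) (x : Pt D) {ν : Pt D}
    (hν : ‖ν‖ = 1) : ‖fderiv ℝ φ x ν‖ ≤ ‖gradC φ x‖ := by
  have h := norm_inner_le_norm (𝕜 := ℂ)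
    (WithLp.toLp 2 fun i => ((ν i : ℝ) : ℂ) : EuclideanSpace ℂ (Fin D)) (gradC φ x)
  have h1 : ‖(WithLp.toLp 2 fun i => ((ν i : ℝ) : ℂ) : EuclideanSpace ℂ (Fin D))‖ = 1 := by
    rw [← hν, EuclideanSpace.norm_eq, EuclideanSpace.norm_eq]
    simp
  rw [h1, one_mul, PiLp.inner_apply] at h
  rw [fderiv_apply_eq_sum_gradC]
  simpa [mul_comm] using h

theorem continuous_gradC {D : ℕ} {φ : Pt D → ℂ} (hφ : IsTest φ) : Continuous (gradC φ) := by
  have := hφ.1.continuous_fderiv (by simp)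
  unfold gradC
  fun_prop

/-- The value of `φ` at `y` is controlled by `φ` and `∇φ` on a segment of length `δ` issuing from
`y`: differentiate `(1 - s / δ) |φ(y - s ν)|²`, which vanishes at the far end. -/
theorem norm_sq_le_integral_normal {D : ℕ} {φ : Pt D → ℂ} (hφ : IsTest φ) {ν : Pt D}
    (hν : ‖ν‖ = 1) {δ : ℝ} (hδ : 0 < δ) (y : Pt D) :
    ‖φ y‖ ^ 2 ≤ ∫ s in (0 : ℝ)..δ,
      ((1 + 1 / δ) * ‖φ (y - s • ν)‖ ^ 2 + ‖gradC φ (y - s • ν)‖ ^ 2) := by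
  have hc := hφ.1.continuous
  have hg := continuous_gradC hφ
  have hfc := hφ.1.continuous_fderiv (by simp)
  set f' : ℝ → ℝ := fun s => -(1 / δ) * ‖φ (y - s • ν)‖ ^ 2 +
    (1 - s / δ) * (2 * inner ℝ (φ (y - s • ν)) (fderiv ℝ φ (y - s • ν) (-ν))) with hf'
  have hd : ∀ s : ℝ, HasDerivAt (fun s : ℝ => (1 - s / δ) * ‖φ (y - s • ν)‖ ^ 2) (f' s) s := by
    intro s
    have h1 : HasDerivAt (fun s : ℝ => y - s • ν) (-ν) s := by
      simpa using ((hasDerivAt_id s).smul_const ν).const_sub y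
    have h2 := ((hφ.1.differentiable (by simp) _).hasFDerivAt.comp_hasDerivAt s h1).norm_sq
    have h3 : HasDerivAt (fun s : ℝ => 1 - s / δ) (-(1 / δ)) s := by
      simpa using ((hasDerivAt_id s).div_const δ).const_sub 1
    exact h3.mul h2
  have hf'c : Continuous f' := by
    simp only [hf']
    fun_prop
  have hI := intervalIntegral.integral_eq_sub_of_hasDerivAt (a := 0) (b := δ)
    (fun s _ => hd s) (hf'c.intervalIntegrable _ _)
  have h0 : ‖φ y‖ ^ 2 = ∫ s in (0 : ℝ)..δ, - f' s := by
    rw [intervalIntegral.integral_neg, hI]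
    simp [hδ.ne']
  rw [h0]
  refine intervalIntegral.integral_mono_on hδ.le (hf'c.neg.intervalIntegrable _ _)
    (Continuous.intervalIntegrable (by fun_prop) _ _) fun s hs => ?_
  have hs1 : 0 ≤ s / δ := div_nonneg hs.1 hδ.le
  have hs2 : s / δ ≤ 1 := (div_le_one hδ).2 hs.2
  have h4 := abs_real_inner_le_norm (φ (y - s • ν)) (fderiv ℝ φ (y - s • ν) (-ν))
  rw [map_neg, norm_neg] at h4
  have h5 := norm_fderiv_apply_le_norm_gradC φ (y - s • ν) hν
  have h6 : -((1 - s / δ) * (2 * inner ℝ (φ (y - s • ν)) (fderiv ℝ φ (y - s • ν) (-ν))))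
      ≤ 2 * (‖φ (y - s • ν)‖ * ‖gradC φ (y - s • ν)‖) := by
    calc _ ≤ |(1 - s / δ) * (2 * inner ℝ (φ (y - s • ν)) (fderiv ℝ φ (y - s • ν) (-ν)))| :=
          neg_le_abs _
      _ = (1 - s / δ) * (2 * |inner ℝ (φ (y - s • ν)) (fderiv ℝ φ (y - s • ν) (-ν))|) := by
          rw [abs_mul, abs_mul, abs_of_nonneg (by linarith : (0 : ℝ) ≤ 1 - s / δ), abs_two]
      _ ≤ 1 * (2 * (‖φ (y - s • ν)‖ * ‖gradC φ (y - s • ν)‖)) := by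
          gcongr
          · linarith
          · rw [map_neg]
            exact h4.trans (by gcongr)
      _ = _ := one_mul _
  simp only [hf']
  nlinarith [sq_nonneg (‖φ (y - s • ν)‖ - ‖gradC φ (y - s • ν)‖)]

/-- `(t, z) ↦ t ν + z`, from `ℝ × ν^⊥` to `ℝ^D`, preserves Lebesgue measure. -/
theorem measurePreserving_normal_add {D : ℕ} {ν : Pt D} (hν : ‖ν‖ = 1) :
    MeasurePreserving (fun p : ℝ × (Submodule.span ℝ {ν})ᗮ => p.1 • ν + (p.2 : Pt D))
      volume volume := by
  have h1 := ((Submodule.span ℝ {ν}).measurePreserving_measurableEquivProd (0 : Pt D)).symm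
  have h2 : MeasurePreserving (LinearIsometryEquiv.toSpanUnitSingleton ν hν) volume volume :=
    LinearIsometryEquiv.measurePreserving _
  have h3 := h2.prod (MeasurePreserving.id (volume : Measure (Submodule.span ℝ {ν})ᗮ))
  rw [InnerProductSpace.euclideanHausdorffMeasure_eq_volume] at h1
  have h4 := h1.comp h3
  have h5 : (fun p : ℝ × (Submodule.span ℝ {ν})ᗮ => p.1 • ν + (p.2 : Pt D)) =
      ((Submodule.span ℝ {ν}).measurableEquivProd (0 : Pt D)).symm ∘
        Prod.map (LinearIsometryEquiv.toSpanUnitSingleton ν hν) id := by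
    ext p : 1
    simp
  rw [h5]
  exact h4

/-- Points lying at depth in `(0, δ)` below a piece of graph contained in `Ω` sweep out a part of
`Ω`, so integrating over them is at most integrating over `Ω`. -/
theorem lintegral_below_graph_le {D : ℕ} {Ω : Set (Pt D)} (hΩ : MeasurableSet Ω) {ν : Pt D}
    (hν : ‖ν‖ = 1) {γ : (Submodule.span ℝ {ν})ᗮ → ℝ} {A : Set (Submodule.span ℝ {ν})ᗮ}
    (hA : MeasurableSet A) {δ : ℝ}
    (hsub : ∀ z ∈ A, ∀ s ∈ Set.Ioc 0 δ, (γ z - s) • ν + (z : Pt D) ∈ Ω)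
    {h : Pt D → ℝ≥0∞} (hh : Measurable h) :
    ∫⁻ z in A, ∫⁻ s in Set.Ioc 0 δ, h ((γ z - s) • ν + (z : Pt D)) ≤ ∫⁻ x in Ω, h x := by
  set P := fun p : ℝ × (Submodule.span ℝ {ν})ᗮ => p.1 • ν + (p.2 : Pt D) with hP
  have hmp : MeasurePreserving P volume volume := measurePreserving_normal_add hν
  have hm : Measurable fun p => Ω.indicator h (P p) := (hh.indicator hΩ).comp hmp.measurable
  calc ∫⁻ z in A, ∫⁻ s in Set.Ioc 0 δ, h ((γ z - s) • ν + (z : Pt D))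
      ≤ ∫⁻ z in A, ∫⁻ s, Ω.indicator h (P (γ z - s, z)) := by
        refine setLIntegral_mono' hA fun z hz => ?_
        rw [← lintegral_indicator measurableSet_Ioc]
        refine lintegral_mono fun s => ?_
        by_cases hs : s ∈ Set.Ioc 0 δ
        · rw [Set.indicator_of_mem hs, Set.indicator_of_mem (hsub z hz s hs)]
        · rw [Set.indicator_of_notMem hs]
          exact zero_le
    _ ≤ ∫⁻ z, ∫⁻ s, Ω.indicator h (P (γ z - s, z)) := setLIntegral_le_lintegral _ _
    _ = ∫⁻ z, ∫⁻ t, Ω.indicator h (P (t, z)) := by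
        refine lintegral_congr fun z => ?_
        exact lintegral_sub_left_eq_self (fun t => Ω.indicator h (P (t, z))) (γ z)
    _ = ∫⁻ p, Ω.indicator h (P p) := by
        rw [Measure.volume_eq_prod, lintegral_prod_symm' _ hm]
    _ = ∫⁻ x in Ω, h x := by
        rw [hmp.lintegral_comp (hh.indicator hΩ), lintegral_indicator hΩ]

/-! ### The trace inequality -/

/-- Integrals over a Lipschitz image of a piece of a `d`-dimensional inner product space, with
respect to the `d`-dimensional Hausdorff measure, are bounded by integrals over the parameters. -/
theorem lintegral_hausdorff_le_of_subset_image {N Y : Type*} [NormedAddCommGroup N]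
    [InnerProductSpace ℝ N] [FiniteDimensional ℝ N] [MeasurableSpace N] [BorelSpace N]
    [EMetricSpace Y] [MeasurableSpace Y] [BorelSpace Y] {d : ℕ} (hd : Module.finrank ℝ N = d)
    {G : N → Y} (hG : Measurable G) {A : Set N} {K : NNReal}
    (hK : LipschitzOnWith K G A) {S : Set Y} (hS : S ⊆ G '' A) {f : Y → ℝ≥0∞}
    (hf : Measurable f) :
    ∫⁻ y in S, f y ∂(Measure.euclideanHausdorffMeasure d : Measure Y) ≤
      (K : ℝ≥0∞) ^ d * ∫⁻ z in A, f (G z) := by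
  have key : (Measure.euclideanHausdorffMeasure d : Measure Y).restrict S ≤
      ((K : ℝ≥0∞) ^ d) • (volume.restrict A).map G := by
    refine Measure.le_iff.2 fun s hs => ?_
    rw [Measure.restrict_apply hs, Measure.smul_apply, Measure.map_apply hG hs,
      Measure.restrict_apply (hG hs), smul_eq_mul]
    have h1 : s ∩ S ⊆ G '' (G ⁻¹' s ∩ A) := by
      rintro y ⟨hys, hyS⟩
      obtain ⟨z, hz, rfl⟩ := hS hyS
      exact ⟨z, ⟨hys, hz⟩, rfl⟩
    refine (measure_mono h1).trans ?_
    have h2 := (hK.mono (Set.inter_subset_right (s := G ⁻¹' s))).hausdorffMeasure_image_le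
      (d := d) (by positivity)
    rw [← InnerProductSpace.euclideanHausdorffMeasure_eq_volume (V := N), hd,
      Measure.euclideanHausdorffMeasure_def, Measure.euclideanHausdorffMeasure_def,
      Measure.smul_apply, Measure.smul_apply, ENNReal.smul_def, ENNReal.smul_def, smul_eq_mul,
      smul_eq_mul, mul_left_comm]
    gcongr
    simpa using h2
  calc _ ≤ ∫⁻ y, f y ∂(((K : ℝ≥0∞) ^ d) • (volume.restrict A).map G) :=
        lintegral_mono' key le_rfl
    _ = _ := by rw [lintegral_smul_measure, lintegral_map hf hG, smul_eq_mul]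

/-- The squared `H¹(Ω)` norm of a test function, as an extended nonnegative real. -/
noncomputable def h1Energy {D : ℕ} (Ω : Set (Pt D)) (φ : Pt D → ℂ) : ℝ≥0∞ :=
  ∫⁻ x in Ω, (‖φ x‖ₑ ^ 2 + ‖gradC φ x‖ₑ ^ 2)

/-- `norm_sq_le_integral_normal` in extended nonnegative reals. -/
theorem enorm_sq_le_lintegral_normal {D : ℕ} {φ : Pt D → ℂ} (hφ : IsTest φ) {ν : Pt D}
    (hν : ‖ν‖ = 1) {δ : ℝ} (hδ : 0 < δ) (y : Pt D) :
    ‖φ y‖ₑ ^ 2 ≤ ENNReal.ofReal (1 + 1 / δ) * ∫⁻ s in Set.Ioc 0 δ,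
      (‖φ (y - s • ν)‖ₑ ^ 2 + ‖gradC φ (y - s • ν)‖ₑ ^ 2) := by
  have hc := hφ.1.continuous
  have hg := continuous_gradC hφ
  have h1 := norm_sq_le_integral_normal hφ hν hδ y
  have hδ' : 0 < 1 / δ := by positivity
  have h2 : ‖φ y‖ ^ 2 ≤ ∫ s in Set.Ioc 0 δ,
      ((1 + 1 / δ) * (‖φ (y - s • ν)‖ ^ 2 + ‖gradC φ (y - s • ν)‖ ^ 2)) := by
    refine h1.trans ?_
    rw [intervalIntegral.integral_of_le hδ.le]
    refine setIntegral_mono_on ?_ ?_ measurableSet_Ioc fun s _ => ?_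
    · exact Continuous.integrableOn_Ioc (by fun_prop)
    · exact Continuous.integrableOn_Ioc (by fun_prop)
    · nlinarith [sq_nonneg ‖gradC φ (y - s • ν)‖]
  rw [integral_const_mul] at h2
  have h3 : ∀ z : Pt D, ‖φ z‖ₑ ^ 2 + ‖gradC φ z‖ₑ ^ 2 =
      ENNReal.ofReal (‖φ z‖ ^ 2 + ‖gradC φ z‖ ^ 2) := fun z => by
    rw [ENNReal.ofReal_add (by positivity) (by positivity), ENNReal.ofReal_pow (norm_nonneg _),
      ENNReal.ofReal_pow (norm_nonneg _), ofReal_norm, ofReal_norm]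
  simp_rw [h3]
  rw [← ofReal_integral_eq_lintegral_ofReal (Continuous.integrableOn_Ioc (by fun_prop))
    (ae_of_all _ fun s => by positivity), ← ENNReal.ofReal_mul (by positivity), ← ofReal_norm,
    ← ENNReal.ofReal_pow (norm_nonneg _)]
  exact ENNReal.ofReal_le_ofReal h2

/-- The trace inequality near one boundary point. -/
theorem exists_local_trace_le {D : ℕ} (hD : 1 ≤ D) {Ω : Set (Pt D)} (hopen : IsOpen Ω)
    {x ν : Pt D} {γ : Pt D → ℝ} {r : ℝ} (hν : ‖ν‖ = 1) (hγ : ContDiff ℝ 2 γ) (hr : 0 < r)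
    (hΩ : ∀ y ∈ Metric.ball x r, y ∈ Ω ↔ inner ℝ ν y < γ (y - (inner ℝ ν y : ℝ) • ν)) :
    ∃ C : ℝ≥0∞, C ≠ ⊤ ∧ ∀ φ : Pt D → ℂ, IsTest φ →
      ∫⁻ y in frontier Ω ∩ Metric.ball x (r / 2), ‖φ y‖ₑ ^ 2
        ∂(Measure.euclideanHausdorffMeasure (D - 1) : Measure (Pt D)) ≤ C * h1Energy Ω φ := by
  set N := (Submodule.span ℝ {ν})ᗮ with hN
  have hνν : inner ℝ ν ν = (1 : ℝ) := by rw [real_inner_self_eq_norm_sq, hν, one_pow]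
  have hNν : ∀ z : N, inner ℝ ν (z : Pt D) = (0 : ℝ) := fun z =>
    Submodule.mem_orthogonal_singleton_iff_inner_right.1 z.2
  have hdim : Module.finrank ℝ N = D - 1 := by
    have : Fact (Module.finrank ℝ (Pt D) = (D - 1) + 1) := ⟨by simp; omega⟩
    exact Submodule.finrank_orthogonal_span_singleton (norm_ne_zero_iff.1 (by simp [hν]))
  set G : N → Pt D := fun z => γ (z : Pt D) • ν + (z : Pt D) with hGdef
  have hG1 : ContDiff ℝ 1 G := by
    have h1 : ContDiff ℝ 1 fun z : N => (z : Pt D) := N.subtypeL.contDiff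
    have h2 : ContDiff ℝ 1 γ := hγ.of_le (by norm_num)
    exact ((h2.comp h1).smul contDiff_const).add h1
  have hGc : Continuous G := hG1.continuous
  obtain ⟨K, hK⟩ := (hG1.contDiffOn (s := Metric.closedBall 0 (‖x‖ + r))).exists_lipschitzOnWith
    one_ne_zero (convex_closedBall _ _) (isCompact_closedBall _ _)
  set A : Set N := Metric.closedBall 0 (‖x‖ + r) ∩ G ⁻¹' Metric.ball x (r / 2) with hAdef
  have hA : MeasurableSet A :=
    measurableSet_closedBall.inter (hGc.measurable measurableSet_ball)
  have hsub : ∀ z ∈ A, ∀ s ∈ Set.Ioc 0 (r / 2), (γ (z : Pt D) - s) • ν + (z : Pt D) ∈ Ω := by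
    intro z hz s hs
    have hin : inner ℝ ν ((γ (z : Pt D) - s) • ν + (z : Pt D)) = γ (z : Pt D) - s := by
      rw [inner_add_right, inner_smul_right, hνν, hNν]; ring
    have hball : (γ (z : Pt D) - s) • ν + (z : Pt D) ∈ Metric.ball x r := by
      have h1 : (γ (z : Pt D) - s) • ν + (z : Pt D) = G z - s • ν := by
        simp only [hGdef, sub_smul]; abel
      have h2 : dist (G z) x < r / 2 := hz.2
      rw [h1, Metric.mem_ball]
      calc dist (G z - s • ν) x ≤ dist (G z - s • ν) (G z) + dist (G z) x := dist_triangle _ _ _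
        _ = s + dist (G z) x := by
          rw [dist_eq_norm, sub_sub_cancel_left, norm_neg, norm_smul, hν, mul_one,
            Real.norm_of_nonneg hs.1.le]
        _ < r := by linarith [hs.2]
    rw [hΩ _ hball, hin, add_sub_cancel_left]
    linarith [hs.1]
  -- a boundary point near `x` is outside `Ω` but a limit of its points, so it lies on the graph
  have hcover : frontier Ω ∩ Metric.ball x (r / 2) ⊆ G '' A := by
    rintro y ⟨hyf, hyb⟩
    have hyr : y ∈ Metric.ball x r := Metric.ball_subset_ball (by linarith) hyb
    have hyΩ : y ∉ Ω := fun h => by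
      rw [hopen.frontier_eq] at hyf; exact hyf.2 h
    set c : ℝ := inner ℝ ν y with hc
    have hle : γ (y - c • ν) ≤ c := not_lt.1 fun h => hyΩ ((hΩ y hyr).2 h)
    have hge : c ≤ γ (y - c • ν) := by
      by_contra! hlt
      have hcont : Continuous fun w : Pt D => γ (w - (inner ℝ ν w : ℝ) • ν) :=
        hγ.continuous.comp (by fun_prop)
      have hopen' : ∀ᶠ w in 𝓝 y, γ (w - (inner ℝ ν w : ℝ) • ν) < inner ℝ ν w :=
        hcont.continuousAt.eventually_lt (by fun_prop) hlt
      have hcl : ∃ᶠ w in 𝓝 y, w ∈ Ω := mem_closure_iff_frequently.1 (frontier_subset_closure hyf)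
      obtain ⟨w, hw1, hw2, hw3⟩ :=
        (hcl.and_eventually (hopen'.and (Metric.isOpen_ball.mem_nhds hyr))).exists
      exact lt_asymm hw2 ((hΩ w hw3).1 hw1)
    have hz : y - c • ν ∈ N := by
      rw [hN, Submodule.mem_orthogonal_singleton_iff_inner_right, inner_sub_right,
        inner_smul_right, hνν, mul_one, sub_self]
    have hGy : G ⟨y - c • ν, hz⟩ = y := by
      simp only [hGdef]
      rw [← le_antisymm hge hle]
      abel
    refine ⟨⟨y - c • ν, hz⟩, ⟨?_, ?_⟩, hGy⟩
    · rw [mem_closedBall_zero_iff, Submodule.coe_norm]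
      -- Pythagoras: the component of `y` orthogonal to `ν` is no longer than `y`
      have h1 : ‖y - c • ν‖ ^ 2 ≤ ‖y‖ ^ 2 := by
        rw [@norm_sub_sq_real, inner_smul_right, real_inner_comm, norm_smul, hν, mul_one,
          Real.norm_eq_abs, sq_abs]
        nlinarith [sq_nonneg c]
      have h2 : ‖y - c • ν‖ ≤ ‖y‖ := le_of_sq_le_sq h1 (norm_nonneg _)
      have h3 : ‖y‖ ≤ ‖x‖ + r := by
        have := norm_le_norm_add_norm_sub' y x
        rw [← dist_eq_norm] at this
        exact this.trans (by linarith [Metric.mem_ball.1 hyr])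
      exact h2.trans h3
    · rw [Set.mem_preimage, hGy]; exact hyb
  -- the graph is a Lipschitz image of `A`, and a layer of depth `r / 2` below it lies in `Ω`
  refine ⟨(K : ℝ≥0∞) ^ (D - 1) * ENNReal.ofReal (1 + 1 / (r / 2)),
    ENNReal.mul_ne_top (by simp) ENNReal.ofReal_ne_top, fun φ hφ => ?_⟩
  have hc := hφ.1.continuous
  have hg := continuous_gradC hφ
  have hm : Measurable fun y => ‖φ y‖ₑ ^ 2 + ‖gradC φ y‖ₑ ^ 2 :=
    Continuous.measurable (by fun_prop)
  calc _ ≤ (K : ℝ≥0∞) ^ (D - 1) * ∫⁻ z in A, ‖φ (G z)‖ₑ ^ 2 :=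
        lintegral_hausdorff_le_of_subset_image hdim hGc.measurable
          (hK.mono Set.inter_subset_left) hcover (Continuous.measurable (by fun_prop))
    _ ≤ (K : ℝ≥0∞) ^ (D - 1) * ∫⁻ z in A, (ENNReal.ofReal (1 + 1 / (r / 2)) *
          ∫⁻ s in Set.Ioc 0 (r / 2), (fun y => ‖φ y‖ₑ ^ 2 + ‖gradC φ y‖ₑ ^ 2)
            ((γ (z : Pt D) - s) • ν + (z : Pt D))) := by
        gcongr with z
        refine (enorm_sq_le_lintegral_normal hφ hν (half_pos hr) (G z)).trans (le_of_eq ?_)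
        have h1 : ∀ s : ℝ, G z - s • ν = (γ (z : Pt D) - s) • ν + (z : Pt D) := fun s => by
          simp only [hGdef, sub_smul]; abel
        simp_rw [h1]
    _ ≤ (K : ℝ≥0∞) ^ (D - 1) * (ENNReal.ofReal (1 + 1 / (r / 2)) * h1Energy Ω φ) := by
        rw [lintegral_const_mul' _ _ ENNReal.ofReal_ne_top]
        gcongr
        exact lintegral_below_graph_le hopen.measurableSet hν hA hsub hm
    _ = _ := by rw [mul_assoc]

/-- The trace inequality `‖φ‖²_{L²(∂Ω)} ≤ C ‖φ‖²_{H¹(Ω)}` on a bounded open set with `C²`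
boundary. -/
theorem exists_trace_le {D : ℕ} (hD : 1 ≤ D) {Ω : Set (Pt D)} (hopen : IsOpen Ω)
    (hbdd : Bornology.IsBounded Ω) (hC2 : HasC2Boundary Ω) :
    ∃ C : ℝ≥0∞, C ≠ ⊤ ∧ ∀ φ : Pt D → ℂ, IsTest φ →
      ∫⁻ y, ‖φ y‖ₑ ^ 2 ∂(surfaceMeasure Ω) ≤ C * h1Energy Ω φ := by
  have hcomp : IsCompact (frontier Ω) :=
    Metric.isCompact_of_isClosed_isBounded isClosed_frontier
      (hbdd.closure.subset frontier_subset_closure)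
  refine hcomp.induction_on (p := fun S => ∃ C : ℝ≥0∞, C ≠ ⊤ ∧ ∀ φ : Pt D → ℂ, IsTest φ →
      ∫⁻ y in S, ‖φ y‖ₑ ^ 2 ∂(Measure.euclideanHausdorffMeasure (D - 1) : Measure (Pt D)) ≤
        C * h1Energy Ω φ) ?_ ?_ ?_ ?_
  · exact ⟨0, by simp, fun φ _ => by simp⟩
  · rintro S T hST ⟨C, hC, h⟩
    exact ⟨C, hC, fun φ hφ => (lintegral_mono_set hST).trans (h φ hφ)⟩
  · rintro S T ⟨C, hC, h⟩ ⟨C', hC', h'⟩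
    refine ⟨C + C', ENNReal.add_ne_top.2 ⟨hC, hC'⟩, fun φ hφ => ?_⟩
    rw [add_mul]
    exact (lintegral_union_le _ _ _).trans (add_le_add (h φ hφ) (h' φ hφ))
  · intro x hx
    obtain ⟨ν, γ, r, hν, hγ, hr, hΩ⟩ := hC2 x hx
    exact ⟨_, inter_mem_nhdsWithin _ (Metric.ball_mem_nhds x (half_pos hr)),
      exists_local_trace_le hD hopen hν hγ hr hΩ⟩

/-! ### The Sobolev space `H¹(Ω)` as a closed subspace -/

/-- The Hilbert space `L²(Ω; ℂ) ⊕ L²(Ω; ℂ^D)` in which `H¹(Ω)` sits as the set of pairs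
`(f, ∇f)`. -/
abbrev PairSpace {D : ℕ} (Ω : Set (Pt D)) := WithLp 2 (L2S Ω × L2V Ω)

/-- The test functions as a complex vector space. -/
def testSpace (D : ℕ) : Submodule ℂ (Pt D → ℂ) where
  carrier := {φ | IsTest φ}
  add_mem' h h' := ⟨h.1.add h'.1, h.2.add h'.2⟩
  zero_mem' := ⟨contDiff_const, HasCompactSupport.zero⟩
  smul_mem' _ _ h := ⟨contDiff_const.smul h.1, h.2.smul_left⟩

theorem IsTest.star {D : ℕ} {φ : Pt D → ℂ} (hφ : IsTest φ) : IsTest fun x => conj (φ x) :=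
  ⟨Complex.conjCLE.contDiff.comp hφ.1, hφ.2.comp_left (map_zero _)⟩

theorem gradC_conj {D : ℕ} {φ : Pt D → ℂ} (hφ : IsTest φ) (x : Pt D) (i : Fin D) :
    gradC (fun x => conj (φ x)) x i = conj (gradC φ x i) := by
  have h := (Complex.conjCLE : ℂ →L[ℝ] ℂ).hasFDerivAt.comp x
    (hφ.1.differentiable (by simp) x).hasFDerivAt
  have h' : fderiv ℝ (fun x => conj (φ x)) x = _ := h.fderiv
  simp [gradC, h']

theorem hasCompactSupport_gradC {D : ℕ} {φ : Pt D → ℂ} (hφ : IsTest φ) :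
    HasCompactSupport (gradC φ) := by
  refine (hφ.2.fderiv ℝ).comp_left (g := fun L : Pt D →L[ℝ] ℂ =>
    (WithLp.toLp 2 fun i => L (EuclideanSpace.single i 1) : EuclideanSpace ℂ (Fin D))) ?_
  ext i
  simp

theorem memLp_test {D : ℕ} {φ : Pt D → ℂ} (hφ : IsTest φ) (Ω : Set (Pt D)) :
    MemLp φ 2 ((volume : Measure (Pt D)).restrict Ω) :=
  hφ.1.continuous.memLp_of_hasCompactSupport hφ.2

theorem memLp_gradC {D : ℕ} {φ : Pt D → ℂ} (hφ : IsTest φ) (Ω : Set (Pt D)) :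
    MemLp (gradC φ) 2 ((volume : Measure (Pt D)).restrict Ω) :=
  (continuous_gradC hφ).memLp_of_hasCompactSupport (hasCompactSupport_gradC hφ)

/-- The pair `(φ, ∇φ)` in `L²(Ω)`, for a test function `φ` on the whole space. -/
noncomputable def testPair {D : ℕ} (Ω : Set (Pt D)) : testSpace D →ₗ[ℂ] PairSpace Ω where
  toFun φ := WithLp.toLp 2 ((memLp_test φ.2 Ω).toLp, (memLp_gradC φ.2 Ω).toLp)
  map_add' φ χ := by
    rw [← WithLp.toLp_add, Prod.mk_add_mk, ← MemLp.toLp_add, ← MemLp.toLp_add]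
    congr 3
    ext x i
    have h := fderiv_add (φ.2.1.differentiable (by simp) x) (χ.2.1.differentiable (by simp) x)
    simp only [gradC, Submodule.coe_add, PiLp.add_apply, Pi.add_apply]
    rw [h]
    rfl
  map_smul' c φ := by
    rw [← WithLp.toLp_smul, Prod.smul_mk, ← MemLp.toLp_const_smul, ← MemLp.toLp_const_smul]
    congr 3
    ext x i
    have h := fderiv_const_smul (𝕜 := ℝ) (φ.2.1.differentiable (by simp) x) c
    simp only [gradC, Submodule.coe_smul, PiLp.smul_apply, Pi.smul_apply, RingHom.id_apply]
    rw [h]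
    rfl

/-- The conjugate of a test function. -/
noncomputable def conjTest {D : ℕ} (φ : testSpace D) : testSpace D :=
  ⟨fun x => conj ((φ : Pt D → ℂ) x), φ.2.star⟩

theorem conjTest_conjTest {D : ℕ} (φ : testSpace D) : conjTest (conjTest φ) = φ := by
  ext x
  simp [conjTest]

/-- The left side of Green's formula is an inner product. The conjugate of the test function enters
because the inner product is conjugate linear in its first argument. -/
theorem inner_testPair_conjTest {D : ℕ} {Ω : Set (Pt D)} (φ : testSpace D) (d : L2S Ω)
    (v : L2V Ω) :
    inner ℂ (testPair Ω (conjTest φ)) (WithLp.toLp 2 (d, v)) =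
      ∫ x in Ω, ((∑ i, v x i * gradC φ x i) + d x * (φ : Pt D → ℂ) x) := by
  have h1 := L2.integrable_inner (𝕜 := ℂ) (memLp_test (conjTest φ).2 Ω).toLp d
  have h2 := L2.integrable_inner (𝕜 := ℂ) (memLp_gradC (conjTest φ).2 Ω).toLp v
  rw [WithLp.prod_inner_apply]
  change inner ℂ (memLp_test (conjTest φ).2 Ω).toLp d +
    inner ℂ (memLp_gradC (conjTest φ).2 Ω).toLp v = _
  rw [L2.inner_def, L2.inner_def, ← integral_add h1 h2]
  refine integral_congr_ae ?_
  filter_upwards [(memLp_test (conjTest φ).2 Ω).coeFn_toLp,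
    (memLp_gradC (conjTest φ).2 Ω).coeFn_toLp] with x hx hx'
  rw [hx, hx', PiLp.inner_apply, add_comm]
  congr 1
  · refine Finset.sum_congr rfl fun i _ => ?_
    have := gradC_conj φ.2 x i
    rw [RCLike.inner_apply]
    change _ * conj (gradC (fun x => conj ((φ : Pt D → ℂ) x)) x i) = _
    rw [this, Complex.conj_conj]
  · simp [conjTest]

theorem memLp_single {D : ℕ} {φ : Pt D → ℂ} (hφ : IsTest φ) (Ω : Set (Pt D)) (i : Fin D) :
    MemLp (fun x => (EuclideanSpace.single i (φ x) : EuclideanSpace ℂ (Fin D))) 2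
      ((volume : Measure (Pt D)).restrict Ω) := by
  have hc := hφ.1.continuous
  refine Continuous.memLp_of_hasCompactSupport ?_
    (hφ.2.comp_left (g := fun z => (EuclideanSpace.single i z : EuclideanSpace ℂ (Fin D)))
      (by simp))
  refine (PiLp.continuous_toLp 2 _).comp (continuous_pi fun j => ?_)
  by_cases hj : j = i
  · subst hj; simpa using hc
  · simpa [hj] using continuous_const

theorem memLp_gradC_apply {D : ℕ} {φ : Pt D → ℂ} (hφ : IsTest φ) (Ω : Set (Pt D)) (i : Fin D) :
    MemLp (fun x => gradC φ x i) 2 ((volume : Measure (Pt D)).restrict Ω) := by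
  exact Continuous.memLp_of_hasCompactSupport
    ((continuous_apply i).comp ((PiLp.continuous_ofLp 2 _).comp (continuous_gradC hφ)))
    ((hasCompactSupport_gradC hφ).comp_left
      (g := fun z : EuclideanSpace ℂ (Fin D) => z i) (by simp))

/-- The vector `(∂_i φ, φ e_i)`: a pair `(f, G)` is orthogonal to it for all `i` and all `φ`
compactly supported in `Ω` exactly if `G = ∇f` weakly. -/
noncomputable def gradDefect {D : ℕ} (Ω : Set (Pt D)) (φ : testSpace D) (i : Fin D) :
    PairSpace Ω :=
  WithLp.toLp 2 ((memLp_gradC_apply φ.2 Ω i).toLp, (memLp_single φ.2 Ω i).toLp)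

/-- `H¹(Ω)`, as the closed subspace of the pairs `(f, ∇f)`. -/
noncomputable def sobolevH1 {D : ℕ} (Ω : Set (Pt D)) : Submodule ℂ (PairSpace Ω) :=
  (Submodule.span ℂ {p | ∃ (φ : testSpace D) (i : Fin D),
    tsupport (φ : Pt D → ℂ) ⊆ Ω ∧ p = gradDefect Ω φ i})ᗮ

theorem tsupport_conjTest {D : ℕ} (φ : testSpace D) :
    tsupport (conjTest φ : Pt D → ℂ) = tsupport (φ : Pt D → ℂ) := by
  unfold tsupport
  congr 1
  ext x
  simp [conjTest]

theorem inner_gradDefect_conjTest {D : ℕ} {Ω : Set (Pt D)} (φ : testSpace D) (i : Fin D)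
    (f : L2S Ω) (G : L2V Ω) :
    inner ℂ (gradDefect Ω (conjTest φ) i) (WithLp.toLp 2 (f, G)) =
      (∫ x in Ω, f x * gradC φ x i) + ∫ x in Ω, G x i * (φ : Pt D → ℂ) x := by
  rw [WithLp.prod_inner_apply]
  change inner ℂ (memLp_gradC_apply (conjTest φ).2 Ω i).toLp f +
    inner ℂ (memLp_single (conjTest φ).2 Ω i).toLp G = _
  rw [L2.inner_def, L2.inner_def]
  congr 1
  · refine integral_congr_ae ?_
    filter_upwards [(memLp_gradC_apply (conjTest φ).2 Ω i).coeFn_toLp] with x hx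
    rw [hx, RCLike.inner_apply]
    change _ * conj (gradC (fun x => conj ((φ : Pt D → ℂ) x)) x i) = _
    rw [gradC_conj φ.2 x i, Complex.conj_conj]
  · refine integral_congr_ae ?_
    filter_upwards [(memLp_single (conjTest φ).2 Ω i).coeFn_toLp] with x hx
    rw [hx, EuclideanSpace.inner_single_left]
    simp [conjTest, mul_comm]

theorem mem_sobolevH1_iff {D : ℕ} {Ω : Set (Pt D)} (f : L2S Ω) (G : L2V Ω) :
    WithLp.toLp 2 (f, G) ∈ sobolevH1 Ω ↔ HasWeakGrad Ω f G := by
  have h0 : WithLp.toLp 2 (f, G) ∈ sobolevH1 Ω ↔ ∀ (φ : testSpace D) (i : Fin D),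
      tsupport (φ : Pt D → ℂ) ⊆ Ω → inner ℂ (gradDefect Ω φ i) (WithLp.toLp 2 (f, G)) = 0 := by
    rw [sobolevH1, Submodule.mem_orthogonal]
    constructor
    · exact fun h φ i hφ => h _ (Submodule.subset_span ⟨φ, i, hφ, rfl⟩)
    · intro h u hu
      induction hu using Submodule.span_induction with
      | mem x hx => obtain ⟨φ, i, hφ, rfl⟩ := hx; exact h φ i hφ
      | zero => simp
      | add x y _ _ hx hy => rw [inner_add_left, hx, hy, add_zero]
      | smul a x _ hx => rw [inner_smul_left, hx, mul_zero]
  rw [h0]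
  constructor
  · intro h φ hφ hs i
    have := h (conjTest ⟨φ, hφ⟩) i (by rw [tsupport_conjTest]; exact hs)
    rw [inner_gradDefect_conjTest] at this
    exact eq_neg_of_add_eq_zero_left this
  · intro h φ i hs
    rw [← conjTest_conjTest φ, inner_gradDefect_conjTest]
    rw [h _ (conjTest φ).2 (by rw [tsupport_conjTest]; exact hs) i, neg_add_cancel]

theorem isClosed_sobolevH1 {D : ℕ} (Ω : Set (Pt D)) : IsClosed (sobolevH1 Ω : Set (PairSpace Ω)) :=
  Submodule.isClosed_orthogonal _

/-- The gradient of a smooth function is its weak gradient. -/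
theorem testPair_mem_sobolevH1 {D : ℕ} {Ω : Set (Pt D)} (φ : testSpace D) :
    testPair Ω φ ∈ sobolevH1 Ω := by
  change WithLp.toLp 2 ((memLp_test φ.2 Ω).toLp, (memLp_gradC φ.2 Ω).toLp) ∈ sobolevH1 Ω
  rw [mem_sobolevH1_iff]
  intro χ hχ hs i
  have h1 : ∫ x in Ω, (memLp_test φ.2 Ω).toLp _ x * gradC χ x i =
      ∫ x, (φ : Pt D → ℂ) x * fderiv ℝ χ x (EuclideanSpace.single i 1) := by
    refine (integral_congr_ae ?_).trans
      (setIntegral_eq_integral_of_forall_compl_eq_zero (s := Ω) ?_)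
    · filter_upwards [(memLp_test φ.2 Ω).coeFn_toLp] with x hx
      rw [hx]; rfl
    · intro x hx
      have : fderiv ℝ χ x = 0 :=
        image_eq_zero_of_notMem_tsupport fun h => hx (hs (tsupport_fderiv_subset ℝ h))
      simp [this]
  have h2 : ∫ x in Ω, (memLp_gradC φ.2 Ω).toLp _ x i * χ x =
      ∫ x, fderiv ℝ (φ : Pt D → ℂ) x (EuclideanSpace.single i 1) * χ x := by
    refine (integral_congr_ae ?_).trans
      (setIntegral_eq_integral_of_forall_compl_eq_zero (s := Ω) ?_)
    · filter_upwards [(memLp_gradC φ.2 Ω).coeFn_toLp] with x hx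
      rw [hx]; rfl
    · intro x hx
      rw [image_eq_zero_of_notMem_tsupport fun h => hx (hs h), mul_zero]
  have hφc := φ.2.1.continuous
  have hχc := hχ.1.continuous
  have hφ' := φ.2.1.continuous_fderiv (by simp)
  have hχ' := hχ.1.continuous_fderiv (by simp)
  rw [h1, h2]
  refine integral_mul_fderiv_eq_neg_fderiv_mul_of_integrable ?_ ?_ ?_
    (fun x _ => φ.2.1.differentiable (by simp) x) (fun x _ => hχ.1.differentiable (by simp) x)
  · exact Continuous.integrable_of_hasCompactSupport (by fun_prop) hχ.2.mul_left
  · exact Continuous.integrable_of_hasCompactSupport (by fun_prop) φ.2.2.mul_right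
  · exact Continuous.integrable_of_hasCompactSupport (by fun_prop) hχ.2.mul_left

/-! ### Real functions, and the boundary functional on `H¹(Ω)` -/

theorem isFiniteMeasure_restrict {D : ℕ} {Ω : Set (Pt D)} (hbdd : Bornology.IsBounded Ω) :
    IsFiniteMeasure ((volume : Measure (Pt D)).restrict Ω) :=
  ⟨by simpa using hbdd.measure_lt_top⟩

/-- The fundamental lemma of the calculus of variations on `Ω`. -/
theorem ae_restrict_eq_zero_of_forall_test {D : ℕ} {Ω : Set (Pt D)} (hopen : IsOpen Ω)
    {E : Type*} [NormedAddCommGroup E] [NormedSpace ℝ E] [CompleteSpace E] {f : Pt D → E}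
    (hf : IntegrableOn f Ω)
    (h : ∀ χ : Pt D → ℝ, ContDiff ℝ ∞ χ → HasCompactSupport χ → tsupport χ ⊆ Ω →
      ∫ x in Ω, χ x • f x = 0) : ∀ᵐ x ∂(volume : Measure (Pt D)).restrict Ω, f x = 0 := by
  rw [ae_restrict_iff' hopen.measurableSet]
  refine hopen.ae_eq_zero_of_integral_contDiff_smul_eq_zero hf.locallyIntegrableOn
    fun χ h1 h2 h3 => ?_
  rw [← h χ h1 h2 h3, setIntegral_eq_integral_of_forall_compl_eq_zero]
  intro x hx
  rw [image_eq_zero_of_notMem_tsupport fun h => hx (h3 h), zero_smul]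

theorem isTest_ofReal {D : ℕ} {χ : Pt D → ℝ} (h1 : ContDiff ℝ ∞ χ) (h2 : HasCompactSupport χ) :
    IsTest fun x => (χ x : ℂ) :=
  ⟨Complex.ofRealCLM.contDiff.comp h1, h2.comp_left (g := fun t : ℝ => (t : ℂ)) (by simp)⟩

theorem tsupport_ofReal_comp {D : ℕ} (χ : Pt D → ℝ) :
    tsupport (fun x => (χ x : ℂ)) = tsupport χ := by
  unfold tsupport
  congr 1
  ext x
  simp

theorem integrableOn_apply {D : ℕ} {Ω : Set (Pt D)} (hbdd : Bornology.IsBounded Ω) (G : L2V Ω)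
    (i : Fin D) : IntegrableOn (fun x => G x i) Ω := by
  have := isFiniteMeasure_restrict hbdd
  exact (EuclideanSpace.proj (𝕜 := ℂ) i).integrable_comp
    ((Lp.memLp G).integrable (by norm_num))

/-- Weak gradients are unique. -/
theorem HasWeakGrad.eq_zero {D : ℕ} {Ω : Set (Pt D)} (hopen : IsOpen Ω)
    (hbdd : Bornology.IsBounded Ω) {G : L2V Ω} (h : HasWeakGrad Ω 0 G) : G = 0 := by
  have hi : ∀ i, ∀ᵐ x ∂(volume : Measure (Pt D)).restrict Ω, G x i = 0 := by
    intro i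
    refine ae_restrict_eq_zero_of_forall_test hopen (integrableOn_apply hbdd G i)
      fun χ h1 h2 h3 => ?_
    have h4 := h _ (isTest_ofReal h1 h2) (by rwa [tsupport_ofReal_comp]) i
    have h5 : ∫ x in Ω, (0 : L2S Ω) x * gradC (fun x => (χ x : ℂ)) x i = 0 := by
      refine integral_eq_zero_of_ae ?_
      filter_upwards [Lp.coeFn_zero ℂ 2 ((volume : Measure (Pt D)).restrict Ω)] with x hx
      rw [hx]; simp
    rw [h5] at h4
    rw [← neg_eq_zero, h4]
    congr 1
    exact integral_congr_ae (ae_of_all _ fun x => by simp [mul_comm])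
  rw [Lp.eq_zero_iff_ae_eq_zero]
  filter_upwards [ae_all_iff.2 hi] with x hx
  ext i
  exact hx i

/-- The weak gradient of a real function is real. -/
theorem HasWeakGrad.ae_im_eq_zero {D : ℕ} {Ω : Set (Pt D)} (hopen : IsOpen Ω)
    (hbdd : Bornology.IsBounded Ω) {f : L2S Ω} {G : L2V Ω} (h : HasWeakGrad Ω f G)
    (hf : ∀ᵐ x ∂((volume : Measure (Pt D)).restrict Ω), (f x).im = 0) (i : Fin D) :
    ∀ᵐ x ∂((volume : Measure (Pt D)).restrict Ω), (G x i).im = 0 := by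
  have hGi := integrableOn_apply hbdd G i
  refine ae_restrict_eq_zero_of_forall_test hopen hGi.im fun χ h1 h2 h3 => ?_
  have ht := isTest_ofReal h1 h2
  have h4 := congrArg Complex.im (h _ ht (by rwa [tsupport_ofReal_comp]) i)
  have h5 : (∫ x in Ω, f x * gradC (fun x => (χ x : ℂ)) x i).im = 0 := by
    have hint : Integrable (fun x => f x * gradC (fun x => (χ x : ℂ)) x i)
        ((volume : Measure (Pt D)).restrict Ω) :=
      (Lp.memLp f).integrable_mul (memLp_gradC_apply ht Ω i)
    have hcomm := Complex.imCLM.integral_comp_comm hint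
    rw [Complex.imCLM_apply] at hcomm
    rw [← hcomm]
    refine integral_eq_zero_of_ae ?_
    filter_upwards [hf] with x hx
    have hreal : (gradC (fun x => (χ x : ℂ)) x i).im = 0 := by
      have hd := Complex.ofRealCLM.hasFDerivAt.comp x
        (h1.differentiable (by simp) x).hasFDerivAt
      have hd' : fderiv ℝ (fun x => (χ x : ℂ)) x = _ := hd.fderiv
      simp [gradC, hd']
    simp [Complex.mul_im, hx, hreal]
  have h6 : Integrable (fun x => G x i * (χ x : ℂ)) ((volume : Measure (Pt D)).restrict Ω) := by
    obtain ⟨C, hC⟩ := h2.exists_bound_of_continuous h1.continuous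
    exact hGi.mul_bdd (c := C) ht.1.continuous.aestronglyMeasurable
      (ae_of_all _ fun x => by simpa using hC x)
  have hcomm := Complex.imCLM.integral_comp_comm h6
  rw [Complex.imCLM_apply] at hcomm
  rw [h5, Complex.neg_im, ← hcomm, eq_comm, neg_eq_zero] at h4
  rw [← h4]
  exact integral_congr_ae (ae_of_all _ fun x => by simp [Complex.mul_im, mul_comm])

theorem tendsto_toLp {α ι E : Type*} {m : MeasurableSpace α} {μ : Measure α}
    [NormedAddCommGroup E] {l : Filter ι} {φ : ι → α → E} (hφ : ∀ j, MemLp (φ j) 2 μ)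
    (f : Lp E 2 μ) (h : Tendsto (fun j => eLpNorm (fun x => f x - φ j x) 2 μ) l (𝓝 0)) :
    Tendsto (fun j => (hφ j).toLp) l (𝓝 f) := by
  rw [Lp.tendsto_Lp_iff_tendsto_eLpNorm']
  refine h.congr fun j => ?_
  rw [← eLpNorm_neg]
  refine eLpNorm_congr_ae ?_
  filter_upwards [(hφ j).coeFn_toLp] with x hx
  simp [hx]

theorem tendsto_testPair {D : ℕ} {Ω : Set (Pt D)} {φ : ℕ → testSpace D} {f : L2S Ω} {G : L2V Ω}
    (h1 : Tendsto (fun j => eLpNorm (fun x => f x - (φ j : Pt D → ℂ) x) 2 (volume.restrict Ω))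
      atTop (𝓝 0))
    (h2 : Tendsto (fun j => eLpNorm (fun x => G x - gradC (φ j : Pt D → ℂ) x) 2
      (volume.restrict Ω)) atTop (𝓝 0)) :
    Tendsto (fun j => testPair Ω (φ j)) atTop (𝓝 (WithLp.toLp 2 (f, G))) :=
  ((WithLp.prod_continuous_toLp 2 _ _).tendsto _).comp
    ((tendsto_toLp (fun j => memLp_test (φ j).2 Ω) f h1).prodMk_nhds
      (tendsto_toLp (fun j => memLp_gradC (φ j).2 Ω) G h2))

/-- If test functions approximate a real function of `H¹(Ω)`, so do their conjugates. -/
theorem tendsto_testPair_conjTest {D : ℕ} {Ω : Set (Pt D)} (hopen : IsOpen Ω)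
    (hbdd : Bornology.IsBounded Ω) {φ : ℕ → testSpace D} {f : L2S Ω} {G : L2V Ω}
    (h : HasWeakGrad Ω f G)
    (hf : ∀ᵐ x ∂((volume : Measure (Pt D)).restrict Ω), (f x).im = 0)
    (h1 : Tendsto (fun j => eLpNorm (fun x => f x - (φ j : Pt D → ℂ) x) 2 (volume.restrict Ω))
      atTop (𝓝 0))
    (h2 : Tendsto (fun j => eLpNorm (fun x => G x - gradC (φ j : Pt D → ℂ) x) 2
      (volume.restrict Ω)) atTop (𝓝 0)) :
    Tendsto (fun j => testPair Ω (conjTest (φ j))) atTop (𝓝 (WithLp.toLp 2 (f, G))) := by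
  have key : ∀ a b : ℂ, a.im = 0 → ‖a - b‖ = ‖a - conj b‖ := by
    intro a b ha
    rw [← Complex.norm_conj, map_sub, Complex.conj_eq_iff_im.2 ha]
  refine tendsto_testPair (h1.congr fun j => eLpNorm_congr_norm_ae ?_)
    (h2.congr fun j => eLpNorm_congr_norm_ae ?_)
  · filter_upwards [hf] with x hx
    exact key _ _ hx
  · filter_upwards [ae_all_iff.2 (h.ae_im_eq_zero hopen hbdd hf)] with x hx
    rw [EuclideanSpace.norm_eq, EuclideanSpace.norm_eq]
    congr 1
    refine Finset.sum_congr rfl fun i _ => ?_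
    have h3 := gradC_conj (φ j).2 x i
    change _ = ‖G x i - gradC (fun x => conj ((φ j : Pt D → ℂ) x)) x i‖ ^ 2
    rw [h3, ← key _ _ (hx i)]
    rfl

/-- A functional that is bounded by the norm of a linear image of its argument is represented by
a vector. -/
theorem exists_inner_eq_of_norm_le {X H : Type*} [AddCommGroup X] [Module ℂ X]
    [NormedAddCommGroup H] [InnerProductSpace ℂ H] [CompleteSpace H] (T : X →ₗ[ℂ] H)
    (L : X →ₗ[ℂ] ℂ) {C : ℝ} (h : ∀ x, ‖L x‖ ≤ C * ‖T x‖) :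
    ∃ w : H, ∀ x, L x = inner ℂ w (T x) := by
  have hker : LinearMap.ker T ≤ LinearMap.ker L := fun x hx => by
    have := h x
    rw [LinearMap.mem_ker.1 hx, norm_zero, mul_zero] at this
    exact norm_le_zero_iff.1 this
  let L₀ : LinearMap.range T →ₗ[ℂ] ℂ :=
    ((LinearMap.ker T).liftQ L hker).comp T.quotKerEquivRange.symm.toLinearMap
  have hL₀ : ∀ x, L₀ ⟨T x, x, rfl⟩ = L x := fun x => by
    have : T.quotKerEquivRange.symm ⟨T x, x, rfl⟩ = (LinearMap.ker T).mkQ x :=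
      T.quotKerEquivRange_symm_apply_image x _
    simp [L₀, this]
  let L₁ : StrongDual ℂ (LinearMap.range T) := L₀.mkContinuous C (by
    rintro ⟨_, x, rfl⟩
    rw [hL₀]
    exact h x)
  obtain ⟨g, hg, -⟩ := exists_extension_norm_eq (LinearMap.range T) L₁
  refine ⟨(InnerProductSpace.toDual ℂ H).symm g, fun x => ?_⟩
  rw [InnerProductSpace.toDual_symm_apply, ← hL₀ x]
  exact (hg ⟨T x, x, rfl⟩).symm

theorem enorm_toLp_sq {α E : Type*} {m : MeasurableSpace α} {μ : Measure α}
    [NormedAddCommGroup E] {f : α → E} (hf : MemLp f 2 μ) :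
    ‖hf.toLp‖ₑ ^ 2 = ∫⁻ x, ‖f x‖ₑ ^ 2 ∂μ := by
  rw [Lp.enorm_toLp]
  simpa using eLpNorm_nnreal_pow_eq_lintegral (f := f) (μ := μ) (p := 2) two_ne_zero

theorem enorm_testPair_sq {D : ℕ} (Ω : Set (Pt D)) (φ : testSpace D) :
    ‖testPair Ω φ‖ₑ ^ 2 = h1Energy Ω φ := by
  have h1 := enorm_toLp_sq (memLp_test φ.2 Ω)
  have h2 := enorm_toLp_sq (memLp_gradC φ.2 Ω)
  have h3 := WithLp.prod_norm_sq_eq_of_L2 (testPair Ω φ)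
  have hc := φ.2.1.continuous
  rw [h1Energy, lintegral_add_left (Continuous.measurable (by fun_prop)), ← h1, ← h2,
    ← ofReal_norm, ← ofReal_norm, ← ofReal_norm, ← ENNReal.ofReal_pow (norm_nonneg _),
    ← ENNReal.ofReal_pow (norm_nonneg _), ← ENNReal.ofReal_pow (norm_nonneg _),
    ← ENNReal.ofReal_add (by positivity) (by positivity), h3]
  rfl

/-- By the trace inequality, test functions are square integrable on the boundary. -/
theorem memLp_surfaceMeasure {D : ℕ} (hD : 1 ≤ D) {Ω : Set (Pt D)} (hopen : IsOpen Ω)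
    (hbdd : Bornology.IsBounded Ω) (hC2 : HasC2Boundary Ω) {φ : Pt D → ℂ} (hφ : IsTest φ) :
    MemLp φ 2 (surfaceMeasure Ω) := by
  obtain ⟨C, hC, h⟩ := exists_trace_le hD hopen hbdd hC2
  refine ⟨hφ.1.continuous.aestronglyMeasurable, ?_⟩
  have h1 : eLpNorm φ 2 (surfaceMeasure Ω) ^ 2 = ∫⁻ y, ‖φ y‖ₑ ^ 2 ∂(surfaceMeasure Ω) := by
    simpa using
      eLpNorm_nnreal_pow_eq_lintegral (f := φ) (μ := surfaceMeasure Ω) (p := 2) two_ne_zero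
  have h2 : h1Energy Ω φ < ⊤ := by
    rw [← enorm_testPair_sq Ω ⟨φ, hφ⟩]
    exact ENNReal.pow_lt_top enorm_lt_top
  have h3 := (h φ hφ).trans_lt (ENNReal.mul_lt_top hC.lt_top h2)
  rw [← h1] at h3
  exact lt_of_not_ge fun h4 => by simp [top_le_iff.1 h4] at h3

/-- `w` represents the functional `φ ↦ ∫_{∂Ω} g φ dσ` of `H¹(Ω)`. -/
def RepresentsBoundary {D : ℕ} (Ω : Set (Pt D)) (g : Pt D → ℂ) (w : PairSpace Ω) : Prop :=
  ∀ φ : testSpace D, ∫ x, g x * (φ : Pt D → ℂ) x ∂(surfaceMeasure Ω) =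
    inner ℂ (testPair Ω (conjTest φ)) w

theorem integral_mul_eq_inner_toLp {α : Type*} {m : MeasurableSpace α} {μ : Measure α}
    {g t : α → ℂ} (hg : MemLp (fun x => conj (g x)) 2 μ) (ht : MemLp t 2 μ) :
    ∫ x, g x * t x ∂μ = inner ℂ hg.toLp ht.toLp := by
  rw [L2.inner_def]
  refine integral_congr_ae ?_
  filter_upwards [hg.coeFn_toLp, ht.coeFn_toLp] with x hx hx'
  rw [hx, hx', RCLike.inner_apply, RCLike.conj_conj, mul_comm]

/-- By the trace inequality, the boundary functional is bounded in the norm of `H¹(Ω)`. -/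
theorem exists_representsBoundary {D : ℕ} (hD : 1 ≤ D) {Ω : Set (Pt D)} (hopen : IsOpen Ω)
    (hbdd : Bornology.IsBounded Ω) (hC2 : HasC2Boundary Ω) {g : Pt D → ℂ}
    (hg : MemLp g 2 (surfaceMeasure Ω)) : ∃ w, RepresentsBoundary Ω g w := by
  obtain ⟨C, hC, hCφ⟩ := exists_trace_le hD hopen hbdd hC2
  have hm : ∀ φ : testSpace D, MemLp (φ : Pt D → ℂ) 2 (surfaceMeasure Ω) := fun φ =>
    memLp_surfaceMeasure hD hopen hbdd hC2 φ.2
  let B : testSpace D →ₗ[ℂ] Lp ℂ 2 (surfaceMeasure Ω) :=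
    { toFun := fun φ => (hm φ).toLp
      map_add' := fun φ χ => MemLp.toLp_add (hm φ) (hm χ)
      map_smul' := fun c φ => MemLp.toLp_const_smul c (hm φ) }
  have hB : ∀ φ, ‖B φ‖ ≤ Real.sqrt C.toReal * ‖testPair Ω φ‖ := by
    intro φ
    have h1 : ‖B φ‖ₑ ^ 2 ≤ C * ‖testPair Ω φ‖ₑ ^ 2 := by
      rw [enorm_testPair_sq]
      exact (enorm_toLp_sq (hm φ)).le.trans (hCφ φ φ.2)
    have h2 := ENNReal.toReal_mono (ENNReal.mul_ne_top hC (ENNReal.pow_ne_top enorm_ne_top)) h1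
    simp only [ENNReal.toReal_pow, ENNReal.toReal_mul, toReal_enorm] at h2
    refine le_of_sq_le_sq ?_ (by positivity)
    rwa [mul_pow, Real.sq_sqrt ENNReal.toReal_nonneg]
  let L : testSpace D →ₗ[ℂ] ℂ := (innerSL ℂ hg.toLp).toLinearMap.comp B
  obtain ⟨w, hw⟩ := exists_inner_eq_of_norm_le (testPair Ω) L
    (C := ‖hg.toLp‖ * Real.sqrt C.toReal) (fun φ => by
      rw [mul_assoc]
      exact (norm_inner_le_norm hg.toLp (B φ)).trans
        (mul_le_mul_of_nonneg_left (hB φ) (norm_nonneg _)))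
  refine ⟨w, fun φ => ?_⟩
  rw [← inner_conj_symm, ← hw (conjTest φ)]
  change _ = conj (inner ℂ hg.toLp (hm (conjTest φ)).toLp)
  rw [inner_conj_symm, L2.inner_def]
  refine integral_congr_ae ?_
  filter_upwards [hg.coeFn_toLp, (hm (conjTest φ)).coeFn_toLp] with x hx hx'
  rw [hx, hx', RCLike.inner_apply]
  simp [conjTest]

/-- The representation of the boundary functional extends from test functions to real functions of
`H¹(Ω)` with a trace. -/
theorem RepresentsBoundary.integral_trace {D : ℕ} (hD : 1 ≤ D) {Ω : Set (Pt D)}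
    (hopen : IsOpen Ω) (hbdd : Bornology.IsBounded Ω) (hC2 : HasC2Boundary Ω) {g : Pt D → ℂ}
    (hg : MemLp g 2 (surfaceMeasure Ω)) {w : PairSpace Ω} (hw : RepresentsBoundary Ω g w)
    {f : L2S Ω} {G : L2V Ω} (h : HasWeakGrad Ω f G)
    (hf : ∀ᵐ x ∂((volume : Measure (Pt D)).restrict Ω), (f x).im = 0) {t : Pt D → ℂ}
    (ht : IsTrace Ω f G t) :
    ∫ x, g x * t x ∂(surfaceMeasure Ω) = inner ℂ (WithLp.toLp 2 (f, G)) w := by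
  obtain ⟨htm, φ, hφ, h1, h2, h3⟩ := ht
  have hm : ∀ j, MemLp (φ j) 2 (surfaceMeasure Ω) := fun j =>
    memLp_surfaceMeasure hD hopen hbdd hC2 (hφ j)
  have hg' : MemLp (fun x => conj (g x)) 2 (surfaceMeasure Ω) := hg.star
  have hlim1 := tendsto_testPair_conjTest hopen hbdd (φ := fun j => ⟨φ j, hφ j⟩) h hf h1 h2
  have hlim2 : Tendsto (fun j => (hm j).toLp) atTop (𝓝 htm.toLp) := by
    refine tendsto_toLp hm _ (h3.congr fun j => eLpNorm_congr_ae ?_)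
    filter_upwards [htm.coeFn_toLp] with x hx
    rw [hx]
  rw [integral_mul_eq_inner_toLp hg' htm]
  refine tendsto_nhds_unique (tendsto_const_nhds.inner hlim2) ?_
  refine (hlim1.inner tendsto_const_nhds).congr fun j => ?_
  rw [← hw ⟨φ j, hφ j⟩, ← integral_mul_eq_inner_toLp]

/-! ### The Fredholm alternative for a diagonalized Helmholtz problem -/

/-- Eigenfunctions `v i`, with eigenvalues `κ i ≥ 0`, of the nonnegative operator `d* d`, where the
operator `d` is given by its closed graph `M`; the `v i` form an orthonormal basis. For
`M = H¹(Ω)` these are the Neumann eigenfunctions of `-Δ`. -/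
structure IsEigenfamily {X Y ι : Type*} [NormedAddCommGroup X] [InnerProductSpace ℂ X]
    [NormedAddCommGroup Y] [InnerProductSpace ℂ Y] (M : Submodule ℂ (WithLp 2 (X × Y)))
    (v : ι → X) (dv : ι → Y) (κ : ι → ℝ) : Prop where
  isClosed : IsClosed (M : Set (WithLp 2 (X × Y)))
  graph : ∀ y, WithLp.toLp 2 ((0 : X), y) ∈ M → y = 0
  mem : ∀ i, WithLp.toLp 2 (v i, dv i) ∈ M
  nonneg : ∀ i, 0 ≤ κ i
  eigen : ∀ i x y, WithLp.toLp 2 (x, y) ∈ M → inner ℂ (dv i) y = κ i * inner ℂ (v i) x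
  orthonormal : Orthonormal ℂ v
  complete : ∀ x, (∀ i, inner ℂ (v i) x = 0) → x = 0

namespace IsEigenfamily

variable {X Y ι : Type*} [NormedAddCommGroup X] [InnerProductSpace ℂ X]
  [NormedAddCommGroup Y] [InnerProductSpace ℂ Y] {M : Submodule ℂ (WithLp 2 (X × Y))}
  {v : ι → X} {dv : ι → Y} {κ : ι → ℝ}

theorem inner_pair (h : IsEigenfamily M v dv κ) (i : ι) {x : X} {y : Y}
    (hxy : WithLp.toLp 2 (x, y) ∈ M) (z : ℝ) :
    inner ℂ (WithLp.toLp 2 (v i, dv i)) (WithLp.toLp 2 (-(z : ℂ) • x, y)) =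
      (κ i - z) * inner ℂ (v i) x := by
  rw [WithLp.prod_inner_apply]
  change inner ℂ (v i) (-(z : ℂ) • x) + inner ℂ (dv i) y = _
  rw [h.eigen i x y hxy, inner_smul_right]
  ring

theorem inner_pair_self (h : IsEigenfamily M v dv κ) (i : ι) {x : X} {y : Y}
    (hxy : WithLp.toLp 2 (x, y) ∈ M) :
    inner ℂ (WithLp.toLp 2 (v i, dv i)) (WithLp.toLp 2 (x, y)) =
      (κ i + 1) * inner ℂ (v i) x := by
  simpa using h.inner_pair i hxy (-1)

/-- The eigenpairs span a dense subspace of `M`. -/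
theorem inner_eq_zero [CompleteSpace X] [CompleteSpace Y] (h : IsEigenfamily M v dv κ)
    {r : WithLp 2 (X × Y)} (hr : ∀ i, inner ℂ (WithLp.toLp 2 (v i, dv i)) r = 0) :
    ∀ p ∈ M, inner ℂ p r = 0 := by
  have : CompleteSpace M := h.isClosed.completeSpace_coe
  obtain ⟨m, hm, s, hs, rfl⟩ := M.exists_add_mem_mem_orthogonal r
  have hm0 : m = 0 := by
    have h1 : m.fst = 0 := h.complete _ fun i => by
      have h2 := hr i
      rw [inner_add_right, (Submodule.mem_orthogonal M s).1 hs _ (h.mem i), add_zero] at h2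
      have h3 := h.inner_pair_self i (x := m.fst) (y := m.snd) hm
      rw [show WithLp.toLp 2 (m.fst, m.snd) = m from rfl, h2] at h3
      have h4 : (κ i + 1 : ℂ) ≠ 0 := by
        exact_mod_cast (by linarith [h.nonneg i] : (0 : ℝ) < κ i + 1).ne'
      exact (mul_eq_zero.1 h3.symm).resolve_left h4
    have h5 : WithLp.toLp 2 ((0 : X), m.snd) = m := by rw [← h1]; rfl
    have h6 := h.graph m.snd (h5 ▸ hm)
    rw [← h5, h6]
    rfl
  intro p hp
  rw [hm0, zero_add]
  exact (Submodule.mem_orthogonal M s).1 hs p hp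

theorem ext_inner [CompleteSpace X] [CompleteSpace Y] (h : IsEigenfamily M v dv κ)
    {r s : WithLp 2 (X × Y)}
    (hr : ∀ i, inner ℂ (WithLp.toLp 2 (v i, dv i)) r = inner ℂ (WithLp.toLp 2 (v i, dv i)) s) :
    ∀ p ∈ M, inner ℂ p r = inner ℂ p s := fun p hp => by
  rw [← sub_eq_zero, ← inner_sub_right]
  exact h.inner_eq_zero (fun i => by rw [inner_sub_right, hr, sub_self]) p hp

/-- Fredholm alternative, necessity: the load of a solvable Helmholtz problem is orthogonal to the
resonant eigenpairs. -/
theorem inner_load_eq_zero (h : IsEigenfamily M v dv κ) {z : ℝ} {R : WithLp 2 (X × Y)} {x : X}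
    {y : Y} (hxy : WithLp.toLp 2 (x, y) ∈ M)
    (hsol : ∀ p ∈ M, inner ℂ p (WithLp.toLp 2 (-(z : ℂ) • x, y)) = inner ℂ p R) (i : ι)
    (hi : κ i = z) : inner ℂ (WithLp.toLp 2 (v i, dv i)) R = 0 := by
  rw [← hsol _ (h.mem i), h.inner_pair i hxy, hi, sub_self, zero_mul]

/-- A solution of the homogeneous Helmholtz problem is a combination of resonant eigenpairs. -/
theorem eq_sum_of_homogeneous (h : IsEigenfamily M v dv κ) {z : ℝ} {x : X} {y : Y}
    (hxy : WithLp.toLp 2 (x, y) ∈ M)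
    (hsol : ∀ p ∈ M, inner ℂ p (WithLp.toLp 2 (-(z : ℂ) • x, y)) = 0) (S : Finset ι)
    (hS : ∀ i, i ∈ S ↔ κ i = z) :
    x = ∑ i ∈ S, inner ℂ (v i) x • v i ∧ y = ∑ i ∈ S, inner ℂ (v i) x • dv i := by
  classical
  have h1 : ∀ i, i ∉ S → inner ℂ (v i) x = 0 := fun i hi => by
    have h2 := hsol _ (h.mem i)
    rw [h.inner_pair i hxy] at h2
    refine (mul_eq_zero.1 h2).resolve_left ?_
    rw [hS] at hi
    exact_mod_cast sub_ne_zero.2 hi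
  have hx : x - ∑ i ∈ S, inner ℂ (v i) x • v i = 0 := h.complete _ fun j => by
    rw [inner_sub_right, inner_sum]
    simp_rw [inner_smul_right, orthonormal_iff_ite.1 h.orthonormal, mul_ite, mul_one, mul_zero,
      Finset.sum_ite_eq]
    split_ifs with hj
    · rw [sub_self]
    · rw [h1 j hj, sub_zero]
  refine ⟨sub_eq_zero.1 hx, sub_eq_zero.1 (h.graph _ ?_)⟩
  have h3 : WithLp.toLp 2 (x, y) - ∑ i ∈ S, inner ℂ (v i) x • WithLp.toLp 2 (v i, dv i) ∈ M :=
    M.sub_mem hxy (M.sum_mem fun i _ => M.smul_mem _ (h.mem i))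
  convert h3 using 1
  rw [← hx]
  simp_rw [← WithLp.toLp_smul]
  rw [← WithLp.toLp_sum, ← WithLp.toLp_sub]
  congr 1
  ext <;> simp [Prod.fst_sum, Prod.snd_sum]

/-- Fredholm alternative, sufficiency: if the eigenvalues stay away from `z` apart from the
resonant ones, then the Helmholtz problem `(d* d - z) x = R` is solvable as soon as the load `R` is
orthogonal to the resonant eigenpairs. -/
theorem exists_solution [CompleteSpace X] [CompleteSpace Y] (h : IsEigenfamily M v dv κ) {z C : ℝ}
    (hC : ∀ i, κ i ≠ z → κ i + 1 ≤ C * |κ i - z|) {R : WithLp 2 (X × Y)}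
    (hR : ∀ i, κ i = z → inner ℂ (WithLp.toLp 2 (v i, dv i)) R = 0) :
    ∃ x y, WithLp.toLp 2 (x, y) ∈ M ∧
      ∀ p ∈ M, inner ℂ p (WithLp.toLp 2 (-(z : ℂ) • x, y)) = inner ℂ p R := by
  classical
  have hpos : ∀ i, 0 < κ i + 1 := fun i => by linarith [h.nonneg i]
  -- the eigenpairs, normalized in the graph norm
  set b : ι → WithLp 2 (X × Y) := fun i =>
    (((Real.sqrt (κ i + 1))⁻¹ : ℝ) : ℂ) • WithLp.toLp 2 (v i, dv i) with hb
  have hsq : ∀ i, (((Real.sqrt (κ i + 1))⁻¹ : ℝ) : ℂ) * (((Real.sqrt (κ i + 1))⁻¹ : ℝ) : ℂ) *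
      (κ i + 1) = 1 := fun i => by
    have h1 : (Real.sqrt (κ i + 1))⁻¹ * (Real.sqrt (κ i + 1))⁻¹ * (κ i + 1) = 1 := by
      rw [← mul_inv, Real.mul_self_sqrt (hpos i).le, inv_mul_cancel₀ (hpos i).ne']
    exact_mod_cast h1
  have hbo : Orthonormal ℂ b := by
    rw [orthonormal_iff_ite]
    intro i j
    rw [hb, inner_smul_left, inner_smul_right, h.inner_pair_self i (h.mem j),
      orthonormal_iff_ite.1 h.orthonormal, Complex.conj_ofReal]
    split_ifs with hij
    · subst hij
      rw [mul_one, ← mul_assoc, hsq]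
    · simp
  set a : ι → ℂ := fun i => (((κ i + 1) / (κ i - z) : ℝ) : ℂ) * inner ℂ (b i) R with ha
  have hab : ∀ i, ‖a i‖ ≤ |C| * ‖inner ℂ (b i) R‖ := fun i => by
    rw [ha, norm_mul]
    by_cases hi : κ i = z
    · simp only [hi, sub_self, div_zero, Complex.ofReal_zero, norm_zero, zero_mul]
      positivity
    · gcongr
      have h1 : 0 < |κ i - z| := abs_pos.2 (sub_ne_zero.2 hi)
      rw [Complex.norm_real, Real.norm_eq_abs, abs_div, abs_of_pos (hpos i), div_le_iff₀ h1]
      exact (hC i hi).trans (by gcongr; exact le_abs_self C)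
  have hsum : Summable fun i => a i • b i := by
    have h1 : Summable fun i => ‖a i‖ ^ 2 := by
      refine Summable.of_nonneg_of_le (fun i => by positivity) (fun i => ?_)
        ((hbo.inner_products_summable (x := R)).mul_left (|C| ^ 2))
      rw [← mul_pow]
      exact pow_le_pow_left₀ (norm_nonneg _) (hab i) 2
    exact (hbo.orthogonalFamily.summable_iff_norm_sq_summable a).2 h1
  set q := ∑' i, a i • b i with hq
  have hqM : q ∈ M := by
    refine h.isClosed.mem_of_tendsto hsum.hasSum (Eventually.of_forall fun s => ?_)
    exact M.sum_mem fun i _ => M.smul_mem _ (M.smul_mem _ (h.mem i))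
  have hbq : ∀ j, inner ℂ (b j) q = a j := fun j => by
    have h1 := hsum.hasSum.mapL (innerSL ℂ (b j))
    refine h1.unique ?_
    have h2 : ∀ i, innerSL ℂ (b j) (a i • b i) = if i = j then a j else 0 := fun i => by
      rw [innerSL_apply_apply, inner_smul_right, orthonormal_iff_ite.1 hbo]
      by_cases hij : j = i
      · simp [hij]
      · simp [hij, Ne.symm hij]
    simp_rw [h2]
    exact hasSum_ite_eq j (a j)
  refine ⟨q.fst, q.snd, hqM, h.ext_inner fun i => ?_⟩
  rw [h.inner_pair i (x := q.fst) (y := q.snd) hqM]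
  have h1 := h.inner_pair_self i (x := q.fst) (y := q.snd) hqM
  rw [show WithLp.toLp 2 (q.fst, q.snd) = q from rfl] at h1
  have hs0 : (((Real.sqrt (κ i + 1))⁻¹ : ℝ) : ℂ) ≠ 0 := by
    exact_mod_cast (inv_pos.2 (Real.sqrt_pos.2 (hpos i))).ne'
  have h2 := hbq i
  rw [ha, hb] at h2
  simp only [inner_smul_left, Complex.conj_ofReal] at h2
  rw [mul_left_comm] at h2
  have h3 := mul_left_cancel₀ hs0 h2
  rw [h1] at h3
  have h4 : (κ i + 1 : ℂ) ≠ 0 := by exact_mod_cast (hpos i).ne'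
  by_cases hi : κ i = z
  · rw [hR i hi, hi, sub_self, zero_mul]
  · have h5 : (κ i - z : ℂ) ≠ 0 := by exact_mod_cast sub_ne_zero.2 hi
    push_cast at h3
    rw [div_mul_eq_mul_div, eq_div_iff h5, mul_assoc] at h3
    rw [mul_comm]
    exact mul_left_cancel₀ h4 h3

end IsEigenfamily

/-! ### The Neumann basis and Green's formula on `H¹(Ω)` -/

/-- On a bounded set the constant `1` agrees with a test function. -/
theorem exists_testPair_eq_one {D : ℕ} {Ω : Set (Pt D)} (hopen : IsOpen Ω)
    (hbdd : Bornology.IsBounded Ω) : ∃ (u : L2S Ω) (χ : testSpace D),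
      (∀ᵐ x ∂(volume : Measure (Pt D)).restrict Ω, u x = 1) ∧
      testPair Ω χ = WithLp.toLp 2 (u, (0 : L2V Ω)) := by
  obtain ⟨R, hR, hΩR⟩ := hbdd.subset_ball_lt 0 (0 : Pt D)
  let B : ContDiffBump (0 : Pt D) := ⟨R, R + 1, hR, by linarith⟩
  have hB : IsTest fun x => (B x : ℂ) := isTest_ofReal B.contDiff B.hasCompactSupport
  have hone : ∀ x ∈ Ω, (fun x => (B x : ℂ)) =ᶠ[𝓝 x] fun _ => 1 := fun x hx => by
    filter_upwards [Metric.isOpen_ball.mem_nhds (hΩR hx)] with y hy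
    rw [B.one_of_mem_closedBall (Metric.ball_subset_closedBall hy), Complex.ofReal_one]
  refine ⟨(memLp_test hB Ω).toLp, ⟨_, hB⟩, ?_, ?_⟩
  · filter_upwards [(memLp_test hB Ω).coeFn_toLp, ae_restrict_mem hopen.measurableSet]
      with x hx hxΩ
    rw [hx, (hone x hxΩ).eq_of_nhds]
  · change WithLp.toLp 2 ((memLp_test hB Ω).toLp, (memLp_gradC hB Ω).toLp) = _
    congr 2
    rw [Lp.eq_zero_iff_ae_eq_zero]
    filter_upwards [(memLp_gradC hB Ω).coeFn_toLp, ae_restrict_mem hopen.measurableSet]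
      with x hx hxΩ
    rw [hx]
    ext i
    simp [gradC, (hone x hxΩ).fderiv_eq]

/-- The Neumann eigenfunctions together with the normalized constant mode, at index `none`, form an
orthonormal basis that diagonalizes the Neumann Laplacian; the constant mode is the restriction of a
test function. -/
theorem IsNeumannBasis.exists_isEigenfamily {D : ℕ} (hD : 1 ≤ D) {Ω : Set (Pt D)}
    (hopen : IsOpen Ω) (hne : Ω.Nonempty) (hbdd : Bornology.IsBounded Ω) {lam : ℕ → ℝ}
    {Ψ : ℕ → L2S Ω} {dΨ : ℕ → L2V Ω} (hΨ : IsNeumannBasis Ω lam Ψ dΨ) :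
    ∃ (u : L2S Ω) (χ : testSpace D), testPair Ω χ = WithLp.toLp 2 (u, (0 : L2V Ω)) ∧
      IsEigenfamily (sobolevH1 Ω) (fun o : Option ℕ => o.elim u Ψ) (fun o => o.elim 0 dΨ)
        (fun o => o.elim 0 fun l => (D : ℝ) / (D + 2) * lam l ^ 2) := by
  obtain ⟨u, χ, hu, hχ⟩ := exists_testPair_eq_one hopen hbdd
  have hmean : ∀ f : L2S Ω, inner ℂ u f = ∫ x in Ω, f x := fun f => by
    rw [L2.inner_def]
    refine integral_congr_ae ?_
    filter_upwards [hu] with x hx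
    simp [hx]
  have hu0 : u ≠ 0 := fun h0 => by
    have h1 : ∀ᵐ x ∂(volume : Measure (Pt D)).restrict Ω, False := by
      filter_upwards [hu, (Lp.eq_zero_iff_ae_eq_zero).1 h0] with x hx hx'
      simp [hx] at hx'
    rw [ae_iff] at h1
    simp only [not_false_eq_true, Set.ofPred_true, Measure.restrict_apply_univ] at h1
    exact hopen.measure_ne_zero volume hne h1
  have hn : (‖u‖ : ℂ) ≠ 0 := by exact_mod_cast norm_ne_zero_iff.2 hu0
  have hmem1 : WithLp.toLp 2 (u, (0 : L2V Ω)) ∈ sobolevH1 Ω := hχ ▸ testPair_mem_sobolevH1 χ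
  have hκ : ∀ l, 0 < (D : ℝ) / (D + 2) * lam l ^ 2 := fun l => by
    have := hΨ.pos l
    have : (0 : ℝ) < D := by exact_mod_cast hD
    positivity
  have hκC : ∀ l, ((((D : ℝ) / (D + 2) * lam l ^ 2 : ℝ)) : ℂ) =
      (D : ℂ) / (D + 2) * (lam l : ℂ) ^ 2 := fun l => by push_cast; rfl
  -- testing the eigenvalue equation with the constant shows that eigenfunctions have mean zero
  have huΨ : ∀ l, inner ℂ u (Ψ l) = 0 := fun l => by
    have h1 := hΨ.eigen l u 0 ((mem_sobolevH1_iff _ _).1 hmem1)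
    rw [inner_zero_left, ← hκC] at h1
    exact (mul_eq_zero.1 h1.symm).resolve_left (by exact_mod_cast (hκ l).ne')
  refine ⟨((‖u‖ : ℂ)⁻¹) • u, ((‖u‖ : ℂ)⁻¹) • χ, ?_, isClosed_sobolevH1 Ω, ?_, ?_, ?_, ?_, ?_, ?_⟩
  · rw [map_smul, hχ, ← WithLp.toLp_smul, Prod.smul_mk, smul_zero]
  · exact fun G hG => ((mem_sobolevH1_iff _ _).1 hG).eq_zero hopen hbdd
  · rintro (_ | l)
    · have h1 := (sobolevH1 Ω).smul_mem ((‖u‖ : ℂ)⁻¹) hmem1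
      rwa [← WithLp.toLp_smul, Prod.smul_mk, smul_zero] at h1
    · exact (mem_sobolevH1_iff _ _).2 (hΨ.weakGrad l)
  · rintro (_ | l)
    · exact le_rfl
    · exact (hκ l).le
  · rintro (_ | l) x y hxy
    · simp
    · have h1 := congrArg conj (hΨ.eigen l x y ((mem_sobolevH1_iff _ _).1 hxy))
      rw [← hκC, map_mul, inner_conj_symm, inner_conj_symm, Complex.conj_ofReal] at h1
      exact h1
  · rw [orthonormal_iff_ite]
    rintro (_ | l) (_ | m)
    · have h1 : ‖((‖u‖ : ℂ)⁻¹) • u‖ = 1 := by simp [norm_smul, hu0]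
      simp [inner_self_eq_norm_sq_to_K, h1]
    · simp [inner_smul_left, huΨ]
    · rw [← inner_conj_symm]
      simp [inner_smul_left, huΨ]
    · simpa using orthonormal_iff_ite.1 hΨ.orthonormal l m
  · intro f hf
    refine hΨ.complete f ?_ fun l => hf (some l)
    have h1 := hf none
    rw [Option.elim_none, inner_smul_left] at h1
    rw [← hmean]
    exact (mul_eq_zero.1 h1).resolve_left (by simpa using hu0)

/-- Green's formula against test functions extends to all of `H¹(Ω)`: it passes to the limit in the
eigenpairs, whose approximation by test functions is part of the trace hypothesis, and to the
constant mode, which is the restriction of a test function. -/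
theorem hasNormalTrace_iff {D : ℕ} (hD : 1 ≤ D) {Ω : Set (Pt D)}
    (hopen : IsOpen Ω) (hne : Ω.Nonempty) (hbdd : Bornology.IsBounded Ω) {lam : ℕ → ℝ}
    {Ψ : ℕ → L2S Ω} {dΨ : ℕ → L2V Ω} (hΨ : IsNeumannBasis Ω lam Ψ dΨ) {ψ : ℕ → Pt D → ℂ}
    (hψ : ∀ l, IsTrace Ω (Ψ l) (dΨ l) (ψ l)) {g : Pt D → ℂ} {w : PairSpace Ω}
    (hw : RepresentsBoundary Ω g w) (v : L2V Ω) (d : L2S Ω) :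
    HasNormalTrace Ω v d g ↔
      ∀ p ∈ sobolevH1 Ω, inner ℂ p (WithLp.toLp 2 (d, v)) = inner ℂ p w := by
  constructor
  · intro h
    have h1 : ∀ φ : testSpace D, inner ℂ (testPair Ω φ) (WithLp.toLp 2 (d, v)) =
        inner ℂ (testPair Ω φ) w := fun φ => by
      rw [← conjTest_conjTest φ, inner_testPair_conjTest, ← hw]
      exact h _ (conjTest φ).2
    obtain ⟨u, χ, hχ, hfam⟩ := hΨ.exists_isEigenfamily hD hopen hne hbdd
    refine hfam.ext_inner ?_
    rintro (_ | l)
    · have h2 := h1 χ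
      rwa [hχ] at h2
    · obtain ⟨-, φ, hφ, h2, h3, -⟩ := hψ l
      have hlim := tendsto_testPair (φ := fun j => ⟨φ j, hφ j⟩) h2 h3
      exact tendsto_nhds_unique (hlim.inner tendsto_const_nhds)
        ((hlim.inner tendsto_const_nhds).congr fun j => (h1 _).symm)
  · intro h φ hφ
    have h1 := h _ (testPair_mem_sobolevH1 (conjTest ⟨φ, hφ⟩))
    rw [inner_testPair_conjTest, ← hw] at h1
    exact h1

/-- Green's formula contains the weak divergence. -/
theorem HasNormalTrace.hasWeakDiv {D : ℕ} {Ω : Set (Pt D)} (hopen : IsOpen Ω) {v : L2V Ω}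
    {d : L2S Ω} {g : Pt D → ℂ} (h : HasNormalTrace Ω v d g) : HasWeakDiv Ω v d := by
  intro φ hφ hs
  have h1 := h φ hφ
  have h2 : ∫ x, g x * φ x ∂(surfaceMeasure Ω) = 0 := by
    refine setIntegral_eq_zero_of_forall_eq_zero fun x hx => ?_
    rw [hopen.frontier_eq] at hx
    rw [image_eq_zero_of_notMem_tsupport fun h => hx.2 (hs h), mul_zero]
  have h3 : Integrable (fun x => ∑ i, v x i * gradC φ x i)
      ((volume : Measure (Pt D)).restrict Ω) :=
    integrable_finsetSum _ fun i _ =>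
      MemLp.integrable_mul (p := 2) (q := 2)
        ((EuclideanSpace.proj (𝕜 := ℂ) i).comp_memLp' (Lp.memLp v)) (memLp_gradC_apply hφ Ω i)
  have h4 : Integrable (fun x => d x * φ x) ((volume : Measure (Pt D)).restrict Ω) :=
    (Lp.memLp d).integrable_mul (memLp_test hφ Ω)
  rw [integral_add h3 h4, h2] at h1
  exact eq_neg_of_add_eq_zero_left h1

/-! ### Reduction of the acoustic problem to the Helmholtz problem -/

/-- `hInner` in terms of the inner products of `L²`; Mathlib's are conjugate linear in the first
argument, `hInner` in the second. -/
theorem hInner_eq {D : ℕ} {Ω : Set (Pt D)} (A B : StateSpace Ω) :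
    hInner A B = inner ℂ B.1 A.1 + inner ℂ B.2.1 A.2.1 + (D : ℂ) / 2 * inner ℂ B.2.2 A.2.2 := by
  have h1 := L2.integrable_inner (𝕜 := ℂ) B.1 A.1
  have h2 := L2.integrable_inner (𝕜 := ℂ) B.2.1 A.2.1
  have h3 := L2.integrable_inner (𝕜 := ℂ) B.2.2 A.2.2
  have h12 : Integrable (fun x => inner ℂ (B.1 x) (A.1 x) + inner ℂ (B.2.1 x) (A.2.1 x))
      ((volume : Measure (Pt D)).restrict Ω) := h1.add h2
  rw [L2.inner_def, L2.inner_def, L2.inner_def, ← integral_const_mul, ← integral_add h1 h2,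
    ← integral_add h12 (h3.const_mul _)]
  rfl

theorem hInner_add_left {D : ℕ} {Ω : Set (Pt D)} (A A' B : StateSpace Ω) :
    hInner (A + A') B = hInner A B + hInner A' B := by
  simp only [hInner_eq, Prod.fst_add, Prod.snd_add, inner_add_right]
  ring

theorem hInner_smul_left {D : ℕ} {Ω : Set (Pt D)} (c : ℂ) (A B : StateSpace Ω) :
    hInner (c • A) B = c * hInner A B := by
  simp only [hInner_eq, Prod.smul_fst, Prod.smul_snd, inner_smul_right]
  ring

theorem hInner_sub_left {D : ℕ} {Ω : Set (Pt D)} (A A' B : StateSpace Ω) :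
    hInner (A - A') B = hInner A B - hInner A' B := by
  simp only [hInner_eq, Prod.fst_sub, Prod.snd_sub, inner_sub_right]
  ring

theorem hInner_sum_left {D : ℕ} {Ω : Set (Pt D)} {ι : Type*} (S : Finset ι)
    (A : ι → StateSpace Ω) (B : StateSpace Ω) :
    hInner (∑ i ∈ S, A i) B = ∑ i ∈ S, hInner (A i) B := by
  simp only [hInner_eq, Prod.fst_sum, Prod.snd_sum, inner_sum, Finset.sum_add_distrib,
    Finset.mul_sum]

theorem hInner_conj_symm {D : ℕ} {Ω : Set (Pt D)} (A B : StateSpace Ω) :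
    conj (hInner A B) = hInner B A := by
  simp only [hInner_eq, map_add, map_mul, inner_conj_symm, map_div₀, map_natCast, map_ofNat]

/-- `V` is a weak solution of `(𝒜 - i s) V = R` with boundary data represented by `w`: the
divergence has been eliminated by `∇ · v = i s ρ + R₁`, and Green's formula is tested against all of
`H¹(Ω)`. -/
def IsWeakAcousticSol {D : ℕ} (Ω : Set (Pt D)) (s : ℝ) (R : StateSpace Ω) (w : PairSpace Ω)
    (V : StateSpace Ω) : Prop :=
  WithLp.toLp 2 (V.1 + V.2.2, (Complex.I * s) • V.2.1 + R.2.1) ∈ sobolevH1 Ω ∧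
  (∀ p ∈ sobolevH1 Ω, inner ℂ p (WithLp.toLp 2 ((Complex.I * s) • V.1 + R.1, V.2.1)) =
    inner ℂ p w) ∧
  (Complex.I * s) • V.2.2 + R.2.2 = (2 / (D : ℂ)) • ((Complex.I * s) • V.1 + R.1)

/-- The strong form of the problem is equivalent to `IsWeakAcousticSol`; the weak divergence is
already contained in Green's formula. -/
theorem solvesAcoustic_iff {D : ℕ} {Ω : Set (Pt D)} (hopen : IsOpen Ω) {g : Pt D → ℂ}
    {w : PairSpace Ω}
    (hw : ∀ v d, HasNormalTrace Ω v d g ↔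
      ∀ p ∈ sobolevH1 Ω, inner ℂ p (WithLp.toLp 2 (d, v)) = inner ℂ p w)
    (s : ℝ) (R V : StateSpace Ω) :
    SolvesAcoustic Ω s R g V ↔ IsWeakAcousticSol Ω s R w V := by
  constructor
  · rintro ⟨W, ⟨-, hgrad, h3⟩, hWR, htr⟩
    have hW : W = (Complex.I * s) • V + R := by rw [← hWR]; abel
    subst hW
    exact ⟨(mem_sobolevH1_iff _ _).2 hgrad, (hw _ _).1 htr, h3⟩
  · rintro ⟨hgrad, htr, h3⟩
    have htr' := (hw _ _).2 htr
    exact ⟨(Complex.I * s) • V + R,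
      ⟨htr'.hasWeakDiv hopen, (mem_sobolevH1_iff _ _).1 hgrad, h3⟩, by abel, htr'⟩

theorem IsWeakAcousticSol.add_const_smul {D : ℕ} {Ω : Set (Pt D)} {s : ℝ} {R R' V V' : StateSpace Ω}
    {w w' : PairSpace Ω} (h : IsWeakAcousticSol Ω s R w V) (h' : IsWeakAcousticSol Ω s R' w' V')
    (c : ℂ) : IsWeakAcousticSol Ω s (R + c • R') (w + c • w') (V + c • V') := by
  obtain ⟨h1, h2, h3⟩ := h
  obtain ⟨h1', h2', h3'⟩ := h'
  refine ⟨?_, fun p hp => ?_, ?_⟩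
  · convert (sobolevH1 Ω).add_mem h1 ((sobolevH1 Ω).smul_mem c h1') using 1
    rw [← WithLp.toLp_smul, ← WithLp.toLp_add]
    congr 1
    ext1
    · simp only [Prod.fst_add, Prod.snd_add, Prod.smul_fst, Prod.smul_snd]
      module
    · simp only [Prod.fst_add, Prod.snd_add, Prod.smul_fst, Prod.smul_snd]
      module
  · rw [inner_add_right, inner_smul_right, ← h2 p hp, ← h2' p hp, ← inner_smul_right,
      ← inner_add_right, ← WithLp.toLp_smul, ← WithLp.toLp_add]
    congr 2
    ext1
    · simp only [Prod.fst_add, Prod.smul_fst]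
      module
    · rfl
  · simp only [Prod.fst_add, Prod.snd_add, Prod.smul_fst, Prod.smul_snd]
    have e1 := h3
    have e2 := congrArg (c • ·) h3'
    linear_combination (norm := module) e1 + e2

/-- The load of the Helmholtz problem satisfied by `q = ρ + θ`. -/
noncomputable def helmholtzLoad {D : ℕ} {Ω : Set (Pt D)} (s : ℝ) (R : StateSpace Ω)
    (w : PairSpace Ω) : PairSpace Ω :=
  (Complex.I * s) • w +
    WithLp.toLp 2 (-(Complex.I * s * (D / (D + 2))) • (R.1 + R.2.2), R.2.1)

/-- `q = ρ + θ`, with gradient `i s v + R₂`, solves the Helmholtz problem. -/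
theorem IsWeakAcousticSol.helmholtz {D : ℕ} (hD : 1 ≤ D) {Ω : Set (Pt D)} {s : ℝ}
    {R V : StateSpace Ω} {w : PairSpace Ω} (h : IsWeakAcousticSol Ω s R w V) :
    ∀ p ∈ sobolevH1 Ω, inner ℂ p (WithLp.toLp 2
      (-(((D : ℝ) / (D + 2) * s ^ 2 : ℝ) : ℂ) • (V.1 + V.2.2),
        (Complex.I * s) • V.2.1 + R.2.1)) = inner ℂ p (helmholtzLoad s R w) := by
  intro p hp
  obtain ⟨-, h2, h3⟩ := h
  rw [helmholtzLoad, inner_add_right, inner_smul_right, ← h2 p hp, ← inner_smul_right,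
    ← inner_add_right, ← WithLp.toLp_smul, ← WithLp.toLp_add]
  -- the two sides differ by a multiple of the energy equation
  congr 2
  have hD0 : (D : ℂ) ≠ 0 := by exact_mod_cast (by omega : D ≠ 0)
  have hD2 : (D : ℂ) + 2 ≠ 0 := by exact_mod_cast (by omega : D + 2 ≠ 0)
  ext1
  · simp only [Prod.smul_mk, Prod.mk_add_mk]
    have h4 : (Complex.I * s * (D / (D + 2))) • ((Complex.I * s) • V.2.2 + R.2.2) =
        (Complex.I * s * (D / (D + 2)) * (2 / (D : ℂ))) • ((Complex.I * s) • V.1 + R.1) := by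
      rw [h3, smul_smul]
    have hI : Complex.I * Complex.I = -1 := Complex.I_mul_I
    have e1 : -(((D : ℝ) / (D + 2) * s ^ 2 : ℝ) : ℂ) =
        Complex.I * s * (D / (D + 2)) * (Complex.I * s) := by
      push_cast
      linear_combination (-(D : ℂ) / (D + 2) * s ^ 2) * hI
    have e2 : Complex.I * s * (D / (D + 2)) * (2 / (D : ℂ)) =
        Complex.I * s - Complex.I * s * (D / (D + 2)) := by
      field_simp
      ring
    rw [e1]
    rw [e2] at h4
    linear_combination (norm := module) h4
  · simp

/-! ### Acoustic modes and solvability -/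

/-- Recovering an acoustic solution from a solution `q` of the Helmholtz problem. -/
theorem exists_isWeakAcousticSol_of_helmholtz {D : ℕ} (hD : 1 ≤ D) {Ω : Set (Pt D)} {s : ℝ}
    (hs : s ≠ 0) {R : StateSpace Ω} {w : PairSpace Ω} {q : L2S Ω} {G : L2V Ω}
    (hq : WithLp.toLp 2 (q, G) ∈ sobolevH1 Ω)
    (h : ∀ p ∈ sobolevH1 Ω, inner ℂ p (WithLp.toLp 2
      (-(((D : ℝ) / (D + 2) * s ^ 2 : ℝ) : ℂ) • q, G)) = inner ℂ p (helmholtzLoad s R w)) :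
    ∃ V, IsWeakAcousticSol Ω s R w V := by
  have hD0 : (D : ℂ) ≠ 0 := by exact_mod_cast (by omega : D ≠ 0)
  have hD2 : (D : ℂ) + 2 ≠ 0 := by exact_mod_cast (by omega : D + 2 ≠ 0)
  have hc : Complex.I * (s : ℂ) ≠ 0 := mul_ne_zero Complex.I_ne_zero (by exact_mod_cast hs)
  have hc2 : (s : ℂ) ^ 2 = -(Complex.I * s) ^ 2 := by
    rw [mul_pow, Complex.I_sq]; ring
  have hz : -(((D : ℝ) / (D + 2) * s ^ 2 : ℝ) : ℂ) = (D : ℂ) / (D + 2) * (Complex.I * s) ^ 2 := by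
    push_cast
    rw [hc2]; ring
  rw [hz] at h
  unfold helmholtzLoad at h
  unfold IsWeakAcousticSol
  generalize Complex.I * (s : ℂ) = c at *
  -- `d` is the divergence of the velocity
  set d : L2S Ω := ((D : ℂ) / (D + 2)) • (c • q + R.1 + R.2.2) with hd
  have e1 : c • (c⁻¹ • (d - R.1)) = d - R.1 := smul_inv_smul₀ hc _
  have e2 : c • (c⁻¹ • (G - R.2.1)) = G - R.2.1 := smul_inv_smul₀ hc _
  have e3 : c • (c⁻¹ • ((2 / (D : ℂ)) • d - R.2.2)) = (2 / (D : ℂ)) • d - R.2.2 :=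
    smul_inv_smul₀ hc _
  refine ⟨(c⁻¹ • (d - R.1), c⁻¹ • (G - R.2.1), c⁻¹ • ((2 / (D : ℂ)) • d - R.2.2)), ?_, ?_, ?_⟩
  · simp only
    rw [e2, sub_add_cancel]
    convert hq using 3
    have e4 : (2 / (D : ℂ)) • d + d = c • q + R.1 + R.2.2 := by
      rw [hd, smul_smul, ← add_smul]
      have : 2 / (D : ℂ) * (D / (D + 2)) + D / (D + 2) = 1 := by field_simp; ring
      rw [this, one_smul]
    rw [← smul_add, show d - R.1 + ((2 / (D : ℂ)) • d - R.2.2) =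
      ((2 / (D : ℂ)) • d + d) - R.1 - R.2.2 by abel, e4,
      show c • q + R.1 + R.2.2 - R.1 - R.2.2 = c • q by abel, inv_smul_smul₀ hc]
  · intro p hp
    simp only
    rw [e1, sub_add_cancel]
    have h1 := h p hp
    rw [inner_add_right, ← sub_eq_iff_eq_add, ← inner_sub_right, inner_smul_right] at h1
    refine mul_left_cancel₀ hc ?_
    rw [← h1, ← inner_smul_right, ← WithLp.toLp_smul, ← WithLp.toLp_sub]
    congr 2
    ext1
    · simp only [Prod.smul_mk, Prod.mk_sub_mk, hd]
      module
    · simp only [Prod.smul_mk, Prod.mk_sub_mk, e2]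
  · simp only
    rw [e1, e3, sub_add_cancel, sub_add_cancel]

theorem hInner_acousticMode {D : ℕ} {Ω : Set (Pt D)} {s : ℝ}
    (A : StateSpace Ω) (Ψ : L2S Ω) (dΨ : L2V Ω) (hD : 1 ≤ D) :
    hInner A (acousticMode s Ψ dΨ) = modeConst D * ((D : ℂ) / (D + 2) * inner ℂ Ψ (A.1 + A.2.2) -
      (Complex.I * s)⁻¹ * inner ℂ dΨ A.2.1) := by
  have hD0 : (D : ℂ) ≠ 0 := by exact_mod_cast (by omega : D ≠ 0)
  have hD2 : (D : ℂ) + 2 ≠ 0 := by exact_mod_cast (by omega : D + 2 ≠ 0)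
  rw [hInner_eq]
  simp only [acousticMode, modeConst, Prod.smul_fst, Prod.smul_snd, inner_smul_left,
    inner_add_right, Complex.conj_ofReal, map_div₀, map_natCast, map_add, map_one, map_mul,
    Complex.conj_I, map_ofNat]
  have e : (1 : ℂ) / (-Complex.I * s) = - (Complex.I * s)⁻¹ := by
    rw [neg_mul, one_div, inv_neg]
  have e' : (D : ℂ) / 2 * (2 / (D + 2)) = D / (D + 2) := by field_simp
  rw [e]
  linear_combination (((√((D + 2) / (2 * D)) : ℝ) : ℂ) * inner ℂ Ψ A.2.2) * e'

/-- The acoustic modes solve the homogeneous problem. -/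
theorem isWeakAcousticSol_acousticMode {D : ℕ} (hD : 1 ≤ D) {Ω : Set (Pt D)} {s : ℝ}
    (hs : s ≠ 0) {Ψ : L2S Ω} {dΨ : L2V Ω} (hmem : WithLp.toLp 2 (Ψ, dΨ) ∈ sobolevH1 Ω)
    (heig : ∀ p ∈ sobolevH1 Ω, inner ℂ p.snd dΨ = ((D : ℂ) / (D + 2) * (s : ℂ) ^ 2) *
      inner ℂ p.fst Ψ) :
    IsWeakAcousticSol Ω s 0 0 (acousticMode s Ψ dΨ) := by
  have hD0 : (D : ℂ) ≠ 0 := by exact_mod_cast (by omega : D ≠ 0)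
  have hD2 : (D : ℂ) + 2 ≠ 0 := by exact_mod_cast (by omega : D + 2 ≠ 0)
  have hc : Complex.I * (s : ℂ) ≠ 0 := mul_ne_zero Complex.I_ne_zero (by exact_mod_cast hs)
  have hc2 : (s : ℂ) ^ 2 = -(Complex.I * s) ^ 2 := by
    rw [mul_pow, Complex.I_sq]; ring
  rw [hc2] at heig
  unfold IsWeakAcousticSol acousticMode
  generalize Complex.I * (s : ℂ) = c at *
  simp only [Prod.smul_mk, Prod.fst_zero, Prod.snd_zero, add_zero]
  refine ⟨?_, fun p hp => ?_, ?_⟩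
  · convert (sobolevH1 Ω).smul_mem (modeConst D) hmem using 1
    rw [← WithLp.toLp_smul, Prod.smul_mk]
    congr 2
    · rw [← smul_add, ← add_smul, ← add_div, div_self hD2, one_smul]
    · rw [smul_comm c, smul_smul c, mul_one_div_cancel hc, one_smul]
  · rw [inner_zero_right, WithLp.prod_inner_apply]
    change inner ℂ p.fst _ + inner ℂ p.snd _ = _
    simp only [inner_smul_right, heig p hp]
    field_simp
    ring
  · simp only [smul_smul]
    congr 1
    field_simp

theorem modeConst_mul_self {D : ℕ} (hD : 1 ≤ D) :
    modeConst D * modeConst D = (D + 2) / (2 * D) := by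
  have hpos : (0 : ℝ) ≤ ((D : ℝ) + 2) / (2 * D) := by positivity
  have h := Real.mul_self_sqrt hpos
  rw [modeConst, ← Complex.ofReal_mul, h]
  push_cast
  rfl

theorem modeConst_ne_zero {D : ℕ} (hD : 1 ≤ D) : modeConst D ≠ 0 := by
  intro h
  have h1 := modeConst_mul_self hD
  have hD0 : (D : ℂ) ≠ 0 := by exact_mod_cast (by omega : D ≠ 0)
  have hD2 : (D : ℂ) + 2 ≠ 0 := by exact_mod_cast (by omega : D + 2 ≠ 0)
  rw [h, mul_zero] at h1
  exact div_ne_zero hD2 (mul_ne_zero two_ne_zero hD0) h1.symm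

/-- The inner products of the acoustic modes at one frequency are those of the eigenfunctions. -/
theorem hInner_acousticMode_acousticMode {D : ℕ} (hD : 1 ≤ D) {Ω : Set (Pt D)} {s : ℝ}
    (hs : s ≠ 0) {Ψ Φ : L2S Ω} {dΨ dΦ : L2V Ω}
    (heig : inner ℂ dΨ dΦ = ((D : ℂ) / (D + 2) * (s : ℂ) ^ 2) * inner ℂ Ψ Φ) :
    hInner (acousticMode s Φ dΦ) (acousticMode s Ψ dΨ) = inner ℂ Ψ Φ := by
  have hD0 : (D : ℂ) ≠ 0 := by exact_mod_cast (by omega : D ≠ 0)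
  have hD2 : (D : ℂ) + 2 ≠ 0 := by exact_mod_cast (by omega : D + 2 ≠ 0)
  have hs0 : (s : ℂ) ≠ 0 := by exact_mod_cast hs
  have h1 := modeConst_mul_self hD
  rw [hInner_acousticMode _ _ _ hD]
  simp only [acousticMode, Prod.smul_mk, inner_add_right, inner_smul_right, heig]
  have hI : Complex.I⁻¹ * Complex.I⁻¹ = -1 := by simp
  have key : modeConst D * modeConst D * ((D : ℂ) / (D + 2) * (D / (D + 2) + 2 / (D + 2)) -
      (Complex.I⁻¹ * Complex.I⁻¹) * (D / (D + 2))) = 1 := by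
    rw [h1, hI]
    field_simp
    ring
  have hss : (s : ℂ)⁻¹ * (s : ℂ)⁻¹ * (s : ℂ) ^ 2 = 1 := by field_simp
  simp only [mul_inv, one_div]
  linear_combination (inner ℂ Ψ Φ) * key - modeConst D * modeConst D * Complex.I⁻¹ * Complex.I⁻¹ *
    (D / (D + 2)) * (inner ℂ Ψ Φ) * hss

/-- The resonance condition on the Helmholtz load, in terms of the acoustic mode. -/
theorem inner_helmholtzLoad_eq_zero_iff {D : ℕ} (hD : 1 ≤ D) {Ω : Set (Pt D)} {s : ℝ}
    (hs : s ≠ 0) (R : StateSpace Ω) (w : PairSpace Ω) (Ψ : L2S Ω) (dΨ : L2V Ω) :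
    inner ℂ (WithLp.toLp 2 (Ψ, dΨ)) (helmholtzLoad s R w) = 0 ↔
      modeConst D * inner ℂ (WithLp.toLp 2 (Ψ, dΨ)) w = hInner R (acousticMode s Ψ dΨ) := by
  have hc : Complex.I * (s : ℂ) ≠ 0 := mul_ne_zero Complex.I_ne_zero (by exact_mod_cast hs)
  rw [hInner_acousticMode _ _ _ hD, mul_right_inj' (modeConst_ne_zero hD), helmholtzLoad,
    inner_add_right, inner_smul_right]
  rw [WithLp.prod_inner_apply _ (WithLp.toLp 2 (-(Complex.I * s * (D / (D + 2))) •
    (R.1 + R.2.2), R.2.1))]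
  simp only [inner_smul_right]
  generalize Complex.I * (s : ℂ) = c at *
  generalize inner ℂ (WithLp.toLp 2 (Ψ, dΨ)) w = a
  generalize inner ℂ Ψ (R.1 + R.2.2) = b
  generalize inner ℂ dΨ R.2.1 = e
  have h1 : c * a + (-(c * (D / (D + 2))) * b + e) = c * (a - (D / (D + 2) * b - c⁻¹ * e)) := by
    field_simp
    ring
  rw [h1, mul_eq_zero, or_iff_right hc, sub_eq_zero]

/-- Eigenvalues tending to infinity keep away from `z`, the resonant ones excepted. -/
theorem exists_gap {κ : ℕ → ℝ} (hκ : Tendsto κ atTop atTop) (z : ℝ) :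
    ∃ C, ∀ i, κ i ≠ z → κ i + 1 ≤ C * |κ i - z| := by
  -- as soon as `κ ≥ 2 z + 1`, the quotient is at most `2`
  have h1 : IsBoundedUnder (· ≤ ·) atTop fun i => (κ i + 1) / |κ i - z| := by
    refine ⟨2, ?_⟩
    rw [eventually_map]
    filter_upwards [hκ.eventually_ge_atTop (2 * z + 1), hκ.eventually_ge_atTop (z + 1)]
      with i h1 h2
    rw [abs_of_pos (by linarith), div_le_iff₀ (by linarith)]
    linarith
  obtain ⟨C, hC⟩ := h1.bddAbove_range
  refine ⟨C, fun i hi => ?_⟩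
  have h2 : (κ i + 1) / |κ i - z| ≤ C := hC ⟨i, rfl⟩
  rwa [div_le_iff₀ (abs_pos.2 (sub_ne_zero.2 hi))] at h2

/-! ### Solutions of the acoustic boundary value problem -/

/-- The sum `ρ + θ` and the velocity of a homogeneous solution determine it, so their expansions in
eigenpairs give an expansion of the solution in acoustic modes. -/
theorem IsWeakAcousticSol.eq_sum_acousticMode {D : ℕ} (hD : 1 ≤ D) {Ω : Set (Pt D)} {s : ℝ}
    (hs : s ≠ 0) {K : StateSpace Ω} {w : PairSpace Ω} (hK : IsWeakAcousticSol Ω s 0 w K)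
    (S : Finset ℕ) (a : ℕ → ℂ) (Ψ : ℕ → L2S Ω) (dΨ : ℕ → L2V Ω)
    (h1 : K.1 + K.2.2 = ∑ l ∈ S, a l • Ψ l)
    (h2 : (Complex.I * s) • K.2.1 = ∑ l ∈ S, a l • dΨ l) :
    K = ∑ l ∈ S, (a l / modeConst D) • acousticMode s (Ψ l) (dΨ l) := by
  have hD0 : (D : ℂ) ≠ 0 := by exact_mod_cast (by omega : D ≠ 0)
  have hD2 : (D : ℂ) + 2 ≠ 0 := by exact_mod_cast (by omega : D + 2 ≠ 0)
  have hm := modeConst_ne_zero hD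
  have hc : Complex.I * (s : ℂ) ≠ 0 := mul_ne_zero Complex.I_ne_zero (by exact_mod_cast hs)
  have h3 : K.2.2 = (2 / (D : ℂ)) • K.1 := by
    have h := hK.2.2
    simp only [Prod.fst_zero, Prod.snd_zero, add_zero] at h
    rw [smul_comm] at h
    exact smul_right_injective _ hc h
  have e0 : ∀ x y : ℂ, x / modeConst D * (modeConst D * y) = x * y := fun x y => by field_simp
  unfold acousticMode
  simp only [smul_smul, e0, Prod.smul_mk]
  have e1 : K.1 = ((D : ℂ) / (D + 2)) • (K.1 + K.2.2) := by
    rw [h3, smul_add, smul_smul, ← add_smul]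
    have : (D : ℂ) / (D + 2) + D / (D + 2) * (2 / D) = 1 := by field_simp
    rw [this, one_smul]
  have e3 : K.2.2 = (2 / ((D : ℂ) + 2)) • (K.1 + K.2.2) := by
    rw [h3, smul_add, smul_smul, ← add_smul]
    congr 1
    field_simp
  ext1
  · rw [Prod.fst_sum, e1, h1, Finset.smul_sum]
    exact Finset.sum_congr rfl fun l _ => by rw [smul_smul, mul_comm]
  ext1
  · rw [Prod.snd_sum, Prod.fst_sum]
    refine smul_right_injective _ hc ?_
    simp only
    rw [h2, Finset.smul_sum]
    refine Finset.sum_congr rfl fun l _ => ?_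
    rw [smul_smul]
    congr 1
    rw [mul_left_comm, mul_one_div_cancel hc, mul_one]
  · rw [Prod.snd_sum, Prod.snd_sum, e3, h1, Finset.smul_sum]
    exact Finset.sum_congr rfl fun l _ => by rw [smul_smul, mul_comm]

theorem helmholtzLoad_zero {D : ℕ} {Ω : Set (Pt D)} (s : ℝ) :
    helmholtzLoad s (0 : StateSpace Ω) 0 = 0 := by
  simp [helmholtzLoad]

/-- The modes at the frequency `s` form an orthonormal basis of the kernel, and the weak problem at
that frequency is solvable exactly if its data are compatible with these modes. -/
theorem IsNeumannBasis.acoustic_fredholm {D : ℕ} (hD : 1 ≤ D) {Ω : Set (Pt D)}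
    (hopen : IsOpen Ω) (hne : Ω.Nonempty) (hbdd : Bornology.IsBounded Ω) {lam : ℕ → ℝ}
    {Ψ : ℕ → L2S Ω} {dΨ : ℕ → L2V Ω} (hΨ : IsNeumannBasis Ω lam Ψ dΨ) {s : ℝ} (hs : s ≠ 0)
    (S : Finset ℕ) (hS : ∀ l, l ∈ S ↔ lam l ^ 2 = s ^ 2) :
    (∀ l ∈ S, IsWeakAcousticSol Ω s 0 0 (acousticMode s (Ψ l) (dΨ l))) ∧
    (∀ l ∈ S, ∀ m ∈ S, hInner (acousticMode s (Ψ l) (dΨ l)) (acousticMode s (Ψ m) (dΨ m)) =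
      if l = m then 1 else 0) ∧
    (∀ K, IsWeakAcousticSol Ω s 0 0 K →
      K = ∑ l ∈ S, hInner K (acousticMode s (Ψ l) (dΨ l)) • acousticMode s (Ψ l) (dΨ l)) ∧
    (∀ R w, (∃ V, IsWeakAcousticSol Ω s R w V) ↔ ∀ l ∈ S,
      modeConst D * inner ℂ (WithLp.toLp 2 (Ψ l, dΨ l)) w =
        hInner R (acousticMode s (Ψ l) (dΨ l))) := by
  classical
  obtain ⟨u, χ, -, hfam⟩ := hΨ.exists_isEigenfamily hD hopen hne hbdd
  have hDpos : (0 : ℝ) < D := by exact_mod_cast hD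
  set z : ℝ := (D : ℝ) / (D + 2) * s ^ 2 with hz
  have hz0 : z ≠ 0 := by positivity
  have hT : ∀ i : Option ℕ, i ∈ S.map Function.Embedding.some ↔
      (i.elim 0 fun l => (D : ℝ) / (D + 2) * lam l ^ 2 : ℝ) = z := by
    rintro (_ | l)
    · simpa using hz0.symm
    · have : (D : ℝ) / (D + 2) ≠ 0 := by positivity
      rw [hz, Option.elim_some, mul_right_inj' this, ← hS]
      simp
  have heig : ∀ l ∈ S, ∀ p ∈ sobolevH1 Ω, inner ℂ p.snd (dΨ l) =
      ((D : ℂ) / (D + 2) * (s : ℂ) ^ 2) * inner ℂ p.fst (Ψ l) := fun l hl p hp => by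
    have h1 := hΨ.eigen l p.fst p.snd ((mem_sobolevH1_iff _ _).1 hp)
    have h2 : (lam l : ℂ) ^ 2 = (s : ℂ) ^ 2 := by exact_mod_cast (hS l).1 hl
    rwa [h2] at h1
  have hmem : ∀ l, WithLp.toLp 2 (Ψ l, dΨ l) ∈ sobolevH1 Ω := fun l =>
    (mem_sobolevH1_iff _ _).2 (hΨ.weakGrad l)
  have hmode : ∀ l ∈ S, IsWeakAcousticSol Ω s 0 0 (acousticMode s (Ψ l) (dΨ l)) := fun l hl =>
    isWeakAcousticSol_acousticMode hD hs (hmem l) (heig l hl)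
  have horth : ∀ l ∈ S, ∀ m ∈ S,
      hInner (acousticMode s (Ψ l) (dΨ l)) (acousticMode s (Ψ m) (dΨ m)) =
        if l = m then 1 else 0 := fun l hl m _ => by
    rw [hInner_acousticMode_acousticMode (Ψ := Ψ m) (dΨ := dΨ m) hD hs (heig l hl _ (hmem m)),
      orthonormal_iff_ite.1 hΨ.orthonormal]
    simp only [eq_comm]
  refine ⟨hmode, horth, fun K hK => ?_, fun R w => ⟨?_, fun h => ?_⟩⟩
  · have h1 := hK.helmholtz hD
    simp only [helmholtzLoad_zero, inner_zero_right] at h1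
    obtain ⟨h2, h3⟩ := hfam.eq_sum_of_homogeneous hK.1 h1 _ hT
    rw [Finset.sum_map] at h2 h3
    simp only [Prod.fst_zero, Prod.snd_zero, add_zero] at h3
    have h4 := hK.eq_sum_acousticMode hD hs S _ Ψ dΨ h2 h3
    -- the coefficients are read off by orthonormality
    have h5 : ∀ m ∈ S, hInner K (acousticMode s (Ψ m) (dΨ m)) =
        inner ℂ (Ψ m) (K.1 + K.2.2) / modeConst D := fun m hm => by
      conv_lhs => rw [h4]
      rw [hInner_sum_left, Finset.sum_congr rfl fun l hl => by
        rw [hInner_smul_left, horth l hl m hm, mul_ite, mul_one, mul_zero]]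
      rw [Finset.sum_ite_eq' S m, if_pos hm]
      rfl
    refine h4.trans (Finset.sum_congr rfl fun l hl => ?_)
    rw [h5 l hl]
    rfl
  · rintro ⟨V, hV⟩ l hl
    rw [← inner_helmholtzLoad_eq_zero_iff hD hs]
    exact hfam.inner_load_eq_zero hV.1 (hV.helmholtz hD) (some l)
      ((hT _).1 (Finset.mem_map_of_mem _ hl))
  · have hlim : Tendsto (fun l => (D : ℝ) / (D + 2) * lam l ^ 2) atTop atTop :=
      ((tendsto_pow_atTop two_ne_zero).comp hΨ.tendsto).const_mul_atTop (by positivity)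
    -- the second constant accounts for the constant mode, whose eigenvalue is `0`
    obtain ⟨C, hC⟩ := exists_gap hlim z
    obtain ⟨q, G, hq, hsol⟩ := hfam.exists_solution (z := z) (C := max C (1 / |z|))
      (R := helmholtzLoad s R w) (by
      rintro (_ | l) hl
      · simp only [Option.elim_none, zero_add, zero_sub, abs_neg]
        rw [← div_le_iff₀ (abs_pos.2 hz0)]
        exact le_max_right _ _
      · exact (hC l hl).trans 
          (mul_le_mul_of_nonneg_right (le_max_left _ _) (abs_nonneg _))) (by
      intro i hi
      obtain ⟨l, hl, rfl⟩ := Finset.mem_map.1 ((hT i).2 hi)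
      exact (inner_helmholtzLoad_eq_zero_iff hD hs R w _ _).2 (h l hl))
    exact exists_isWeakAcousticSol_of_helmholtz hD hs hq hsol

theorem lemma5p1 {D : ℕ} (hD : 2 ≤ D) (Ω : Set (Pt D)) (hopen : IsOpen Ω)
    (hconn : IsConnected Ω) (hbdd : Bornology.IsBounded Ω) (hC2 : HasC2Boundary Ω)
    (lam : ℕ → ℝ) (Ψ : ℕ → L2S Ω) (dΨ : ℕ → L2V Ω) (hΨ : IsNeumannBasis Ω lam Ψ dΨ)
    (ψ : ℕ → Pt D → ℂ) (hψ : ∀ l, IsTrace Ω (Ψ l) (dΨ l) (ψ l))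
    (τ : ℝ) (hτ : τ = 1 ∨ τ = -1)
    (U : ℕ → StateSpace Ω) (hU : ∀ l, U l = acousticMode (τ * lam l) (Ψ l) (dΨ l))
    (k : ℕ) (μ : ℂ) (F : StateSpace Ω)
    (g : Pt D → ℂ) (hg : MemLp g 2 (surfaceMeasure Ω))
    -- `Sol V`: the boundary value problem; its two solvability conditions
    (Sol : StateSpace Ω → Prop)
    (hSol : ∀ V, Sol V ↔ SolvesAcoustic Ω (τ * lam k) ((Complex.I * μ) • U k + F) g V)
    (CondMu CondCompat : Prop)
    (hCondMu : CondMu ↔ Complex.I * μ =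
      modeConst D * (∫ x, g x * ψ k x ∂(surfaceMeasure Ω)) - hInner F (U k))
    (hCondCompat : CondCompat ↔ ∀ l, lam l = lam k → l ≠ k →
      modeConst D * (∫ x, g x * ψ l x ∂(surfaceMeasure Ω)) = hInner F (U l)) :
    -- simple eigenvalue: the first condition alone characterizes solvability
    ((∀ l, lam l = lam k → l = k) → ((∃ V, Sol V) ↔ CondMu)) ∧
    -- in general (in particular for a multiple eigenvalue) both are needed, and they suffice
    ((∃ V, Sol V) ↔ CondMu ∧ CondCompat) ∧
    -- the solutions, modulo the kernel
    (CondMu ∧ CondCompat → ∃ V₁ ∈ acousticKerPerp Ω (τ * lam k), Sol V₁ ∧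
      (∀ V ∈ acousticKerPerp Ω (τ * lam k), Sol V → V = V₁) ∧
      (∀ V, Sol V ↔ V - V₁ ∈ acousticKer Ω (τ * lam k)) ∧
      (∀ V, Sol V → V = (∑ᶠ l ∈ {l | lam l = lam k}, hInner V (U l) • U l) + V₁)) := by
  classical
  have hD1 : 1 ≤ D := by omega
  have hne : Ω.Nonempty := hconn.nonempty
  set s : ℝ := τ * lam k with hs_def
  have hτ2 : τ ^ 2 = 1 := by rcases hτ with rfl | rfl <;> norm_num
  have hs2 : s ^ 2 = lam k ^ 2 := by rw [hs_def, mul_pow, hτ2, one_mul]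
  have hs : s ≠ 0 := fun h => by
    rw [h] at hs2
    exact (pow_pos (hΨ.pos k) 2).ne (by simpa using hs2)
  -- only finitely many eigenvalues coincide with `lam k`
  have hfin : {l | lam l = lam k}.Finite := by
    have h1 : {l | lam l ≤ lam k}.Finite := by
      have h2 := hΨ.tendsto.eventually_gt_atTop (lam k)
      rw [← Nat.cofinite_eq_atTop, eventually_cofinite] at h2
      simpa using h2
    exact h1.subset fun l hl => le_of_eq hl
  set S : Finset ℕ := hfin.toFinset with hSdef
  have hS : ∀ l, l ∈ S ↔ lam l = lam k := fun l => by simp [hSdef]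
  have hS2 : ∀ l, l ∈ S ↔ lam l ^ 2 = s ^ 2 := fun l => by
    rw [hS, hs2, pow_left_inj₀ (hΨ.pos l).le (hΨ.pos k).le two_ne_zero]
  have hkS : k ∈ S := (hS k).2 rfl
  have hUS : ∀ l ∈ S, U l = acousticMode s (Ψ l) (dΨ l) := fun l hl => by
    rw [hU, (hS l).1 hl]
  obtain ⟨hmode, horth, hspan, hsolv⟩ := hΨ.acoustic_fredholm hD1 hopen hne hbdd hs S hS2
  have hmodeU : ∀ l ∈ S, IsWeakAcousticSol Ω s 0 0 (U l) := fun l hl => hUS l hl ▸ hmode l hl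
  have horthU : ∀ l ∈ S, ∀ m ∈ S, hInner (U l) (U m) = if l = m then 1 else 0 :=
    fun l hl m hm => by rw [hUS l hl, hUS m hm]; exact horth l hl m hm
  have hspanU : ∀ K, IsWeakAcousticSol Ω s 0 0 K → K = ∑ l ∈ S, hInner K (U l) • U l :=
    fun K hK => (hspan K hK).trans (Finset.sum_congr rfl fun l hl => by rw [hUS l hl])
  -- pass to the weak formulation, for the problem and for the kernel
  obtain ⟨w, hw⟩ := exists_representsBoundary hD1 hopen hbdd hC2 hg
  have hw0 : RepresentsBoundary Ω (0 : Pt D → ℂ) 0 := fun φ => by simp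
  set R : StateSpace Ω := (Complex.I * μ) • U k + F with hR
  have hSol' : ∀ V, Sol V ↔ IsWeakAcousticSol Ω s R w V := fun V => by
    rw [hSol, solvesAcoustic_iff hopen (hasNormalTrace_iff hD1 hopen hne hbdd hΨ hψ hw)]
  have hKer : ∀ K, K ∈ acousticKer Ω s ↔ IsWeakAcousticSol Ω s 0 0 K := fun K =>
    solvesAcoustic_iff hopen (hasNormalTrace_iff hD1 hopen hne hbdd hΨ hψ hw0) s 0 K
  have htrace : ∀ l, ∫ x, g x * ψ l x ∂(surfaceMeasure Ω) =
      inner ℂ (WithLp.toLp 2 (Ψ l, dΨ l)) w := fun l =>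
    hw.integral_trace hD1 hopen hbdd hC2 hg (hΨ.weakGrad l) (hΨ.real l) (hψ l)
  have hRU : ∀ l ∈ S, hInner R (U l) = (if l = k then Complex.I * μ else 0) + hInner F (U l) :=
    fun l hl => by
      rw [hR, hInner_add_left, hInner_smul_left, horthU k hkS l hl]
      simp only [eq_comm, mul_ite, mul_one, mul_zero]
  have hmain : (∃ V, Sol V) ↔ CondMu ∧ CondCompat := by
    simp_rw [hSol']
    rw [hsolv, hCondMu, hCondCompat]
    constructor
    · intro h
      refine ⟨?_, fun l hl hlk => ?_⟩
      · have h1 := h k hkS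
        rw [← hUS k hkS, hRU k hkS, if_pos rfl, ← htrace] at h1
        rw [h1, add_sub_cancel_right]
      · have hlS := (hS l).2 hl
        have h1 := h l hlS
        rwa [← hUS l hlS, hRU l hlS, if_neg hlk, zero_add, ← htrace] at h1
    · rintro ⟨h1, h2⟩ l hl
      rw [← hUS l hl, hRU l hl, ← htrace]
      by_cases hlk : l = k
      · subst hlk
        rw [if_pos rfl, h1, sub_add_cancel]
      · rw [if_neg hlk, zero_add]
        exact h2 l ((hS l).1 hl) hlk
  refine ⟨fun hsimple => ?_, hmain, fun hcond => ?_⟩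
  · rw [hmain, and_iff_left_iff_imp, hCondCompat]
    exact fun _ l hl hlk => absurd (hsimple l hl) hlk
  -- `V₁` is any solution minus its component along the modes
  obtain ⟨V₀, hV₀⟩ := hmain.2 hcond
  rw [hSol'] at hV₀
  -- sums of modes solve the homogeneous problem
  have hsumker : ∀ (a : ℕ → ℂ) (T : Finset ℕ), T ⊆ S →
      IsWeakAcousticSol Ω s 0 0 (∑ l ∈ T, a l • U l) := by
    intro a T
    induction T using Finset.induction_on with
    | empty =>
      intro _
      have h1 := (hmodeU k hkS).add_const_smul (hmodeU k hkS) (-1)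
      simpa using h1
    | insert m T hm ih =>
      intro hT
      have h1 := (ih ((Finset.subset_insert _ _).trans hT)).add_const_smul
        (hmodeU m (hT (Finset.mem_insert_self _ _))) (a m)
      rw [Finset.sum_insert hm, add_comm]
      simpa using h1
  have hsub : ∀ V V', IsWeakAcousticSol Ω s R w V → IsWeakAcousticSol Ω s R w V' →
      IsWeakAcousticSol Ω s 0 0 (V - V') := fun V V' h h' => by
    have h1 := h.add_const_smul h' (-1)
    simpa [← sub_eq_add_neg] using h1
  set V₁ : StateSpace Ω := V₀ - ∑ l ∈ S, hInner V₀ (U l) • U l with hV₁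
  have hV₁sol : IsWeakAcousticSol Ω s R w V₁ := by
    have h1 := hV₀.add_const_smul (hsumker (fun l => hInner V₀ (U l)) S subset_rfl) (-1)
    simpa [hV₁, ← sub_eq_add_neg] using h1
  have hV₁U : ∀ m ∈ S, hInner V₁ (U m) = 0 := fun m hm => by
    rw [hV₁, hInner_sub_left, hInner_sum_left, Finset.sum_congr rfl fun l hl => by
      rw [hInner_smul_left, horthU l hl m hm, mul_ite, mul_one, mul_zero],
      Finset.sum_ite_eq' S m, if_pos hm, sub_self]
  have hdecomp : ∀ V, IsWeakAcousticSol Ω s R w V →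
      V = (∑ l ∈ S, hInner V (U l) • U l) + V₁ := fun V hV => by
    have h1 := hspanU _ (hsub V V₁ hV hV₁sol)
    rw [Finset.sum_congr rfl fun l hl => by rw [hInner_sub_left, hV₁U l hl, sub_zero]] at h1
    rw [← h1, sub_add_cancel]
  have hperp : ∀ V, V ∈ acousticKerPerp Ω s ↔ ∀ l ∈ S, hInner V (U l) = 0 := fun V => by
    constructor
    · exact fun h l hl => h _ ((hKer _).2 (hmodeU l hl))
    · intro h K hK
      rw [← hInner_conj_symm, hspanU K ((hKer K).1 hK), hInner_sum_left,
        Finset.sum_eq_zero fun l hl => ?_, map_zero]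
      rw [hInner_smul_left, ← hInner_conj_symm V (U l), h l hl, map_zero, mul_zero]
  refine ⟨V₁, (hperp V₁).2 hV₁U, (hSol' V₁).2 hV₁sol, fun V hV hVs => ?_, fun V => ?_,
    fun V hV => ?_⟩
  · rw [hSol'] at hVs
    have h1 := hdecomp V hVs
    rwa [Finset.sum_eq_zero fun l hl => by rw [(hperp V).1 hV l hl, zero_smul], zero_add] at h1
  · rw [hSol', hKer]
    refine ⟨fun h => hsub V V₁ h hV₁sol, fun h => ?_⟩
    have h1 := hV₁sol.add_const_smul h 1
    simpa using h1
  · rw [finsum_mem_eq_finite_toFinset_sum _ hfin]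
    exact hdecomp V ((hSol' V).1 hV)
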